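/- **Setup.** Fix costs $c_{\rm rew},c_{\rm ver}>0$. For a prompt $x$, a generator $\pi(\cdot\mid x)$ (a probability measure on a measurable response space), a measurable reward model $\mathsf{RM}(x,\cdot)$ with real values and a measurable verifier $\mathsf{Ver}(x,\cdot)$ with values in $\{0,1\}$ induce the random pair $(R,V)=(\mathsf{RM}(x,Y),\mathsf{Ver}(x,Y))$, $Y\sim\pi(\cdot\mid x)$. Let $\mathcal D$ be the law of $R$ and let $h^\star:\mathbb R\to[0,1]$ be a version of the conditional probability $h^\star(r)=\Pr(V=1\mid R=r)$. The prompt is *feasible* if $\Pr(V=1)>0$. **Policies.** A *sound active search policy* is a randomized sequential procedure that at each time, as a measurable function of its own independent randomness and of the scores, chosen indices and labels observed so far, either *generates* (draws a fresh response $Y\sim\pi(\cdot\mid x)$, observes its score, pays $c_{\rm rew}$, adds it to the pool of unverified candidates) or *verifies* (chooses a candidate in the unverified pool, pays $c_{\rm ver}$, observes its label $V_i$, where $V_i\sim\mathrm{Bernoulli}(h^\star(R_i))$ given $R_i$, and removes it from the pool). It stops at the first label $V_i=1$, and then outputs $Y_i$. Its cost is $J=c_{\rm rew}N_{\rm rew}+c_{\rm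 ver}N_{\rm ver}$, where $N_{\rm rew}$ and $N_{\rm ver}$ are the numbers of generated candidates and of verifier calls before stopping, and $J=+\infty$ if no positive label is ever observed. Let $J^\star(h^\star,\mathcal D)$ be the infimum of $\mathbb E[J]$ over all sound active search policies, where the policy may be chosen with knowledge of $(\mathcal D,h^\star)$. **The shellwise policy $\mathcal A_{\rm ADAP}$.** Let $c_{\min}=\min\{c_{\rm rew},c_{\rm ver}\}$ and start with the empty pool. For $s=0,1,2,\dots$ let $$\mathcal S_s=\bigl\{(a,b)\in\mathbb Z_{\ge0}^2:\ a\le b,\ 2^sc_{\min}\le c_{\rm rew}2^b+c_{\rm ver}2^{b-a}<2^{s+1}c_{\min}\bigr\}.$$ If $\mathcal S_s=\emptyset$, go on to the next $s$. Otherwise put $m_s=2^{b_s+1}$ with $b_s=\max\{b:(a,b)\in\mathcal S_s\}$ and $k_s=6\cdot2^{j_s}$ with $j_s=\max\{b-a:(a,b)\in\mathcal S_s\}$; generate $m_s$ fresh candidates and add them to the pool; rank the whole pool by non-increasing score (ties are broken by any fixed measurable rule); verify the candidates of rank $1,\dots,\min\{k_s,|\text{pool}|\}$ one by one in this order, removing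 each verified candidate from the pool, and stop and return the candidate as soon as its label is $1$. **Theorem.** $\mathcal A_{\rm ADAP}$, which depends only on $c_{\rm rew}$, $c_{\rm ver}$ and the tie-breaking rule, is a sound active search policy. For every feasible prompt $x$, all $\pi(\cdot\mid x)$, $\mathsf{RM}$, $\mathsf{Ver}$, and every induced pair $(\mathcal D,h^\star)$ with $h^\star$ non-decreasing, every response $y$ that it returns satisfies $\mathsf{Ver}(x,y)=1$, it returns a response almost surely, and $$\mathbb E\bigl[J(\mathcal A_{\rm ADAP};h^\star,\mathcal D)\bigr]\ \le\ 400\,J^\star(h^\star,\mathcal D).$$ -/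

import Mathlib

open MeasureTheory
open scoped ENNReal

namespace ActiveSearch

/-! ### Instances -/

/-- An active search instance: a law `D` of the reward score and a score-conditioned
success function `h` with values in `[0, 1]`. -/
structure SearchInstance where
  D : Measure ℝ
  isProb : IsProbabilityMeasure D
  h : ℝ → ℝ
  measurable_h : Measurable h
  h_mem : ∀ r, h r ∈ Set.Icc (0 : ℝ) 1

attribute [instance] SearchInstance.isProb

/-- The joint law of `(R, V)` where `R ∼ D` and, conditionally on `R`, `V ∼ Bernoulli (h R)`. -/
noncomputable def SearchInstance.pairLaw (I : SearchInstance) : Measure (ℝ × Bool) :=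
  (I.D.withDensity fun r => ENNReal.ofReal (I.h r)).map (fun r => (r, true)) +
    (I.D.withDensity fun r => ENNReal.ofReal (1 - I.h r)).map (fun r => (r, false))

instance SearchInstance.isProb_pairLaw (I : SearchInstance) :
    IsProbabilityMeasure I.pairLaw := by
  constructor
  have hm := I.measurable_h
  have m1 : Measurable (fun r : ℝ => (r, true)) := by fun_prop
  have m2 : Measurable (fun r : ℝ => (r, false)) := by fun_prop
  rw [SearchInstance.pairLaw, Measure.add_apply, Measure.map_apply m1 MeasurableSet.univ,
    Measure.map_apply m2 MeasurableSet.univ, Set.preimage_univ, Set.preimage_univ,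
    withDensity_apply _ MeasurableSet.univ, withDensity_apply _ MeasurableSet.univ,
    Measure.restrict_univ, ← lintegral_add_left hm.ennreal_ofReal]
  have key : ∀ r, ENNReal.ofReal (I.h r) + ENNReal.ofReal (1 - I.h r) = 1 := fun r => by
    rw [← ENNReal.ofReal_add (I.h_mem r).1 (sub_nonneg.2 (I.h_mem r).2)]
    simp
  simp [key]

/-- `I` is an instance induced by a generator law `μ` on responses, a reward model `RM` and a
verifier `Ver`: `I.D` is the law of the score, and `I.h` is a version of the conditional
probability `r ↦ P(Ver = 1 ∣ RM = r)`. -/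
def SearchInstance.InducedBy {𝒴 : Type*} [MeasurableSpace 𝒴] (I : SearchInstance)
    (μ : Measure 𝒴) (RM : 𝒴 → ℝ) (Ver : 𝒴 → Bool) : Prop :=
  I.D = μ.map RM ∧
    ∀ B : Set ℝ, MeasurableSet B →
      μ {y | RM y ∈ B ∧ Ver y = true} = ∫⁻ r in B, ENNReal.ofReal (I.h r) ∂I.D

/-! ### Policies -/

/-- What a policy observes: `Sum.inl r` is the score of a freshly generated candidate,
`Sum.inr (i, v)` is the verifier label `v` of candidate `i`. Candidates are numbered
`0, 1, 2, …` in the order of their generation. -/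
abbrev Event := ℝ ⊕ (ℕ × Bool)

/-- The two elementary actions. -/
inductive Action where
  | generate : Action
  | verify (i : ℕ) : Action

/-- Number of candidates generated in a history (histories are lists, newest event first). -/
def numRew (H : List Event) : ℕ := H.countP Sum.isLeft

/-- Number of verifier calls in a history. -/
def numVer (H : List Event) : ℕ := H.countP Sum.isRight

/-- Candidate `i` has been generated and has not been verified. -/
def InPool (H : List Event) (i : ℕ) : Prop :=
  i < numRew H ∧ ∀ v : Bool, Sum.inr (i, v) ∉ H

/-- The candidate that was accepted in the last step, if there is one. -/
def accepted : List Event → Option ℕ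
  | Sum.inr (i, true) :: _ => some i
  | _ => none

/-- A randomized sequential procedure: a random seed is drawn once, and each action is a
function of the seed and the observed history. -/
structure Policy where
  Seed : Type
  mSeed : MeasurableSpace Seed
  seedLaw : Measure Seed
  isProb : IsProbabilityMeasure seedLaw
  act : Seed → List Event → Action

attribute [instance] Policy.mSeed Policy.isProb

/-- The history after at most `n` actions on the candidates `ω i = (score, label)`;
the run stops at the first positive label. -/
def Policy.history (A : Policy) (u : A.Seed) (ω : ℕ → ℝ × Bool) : ℕ → List Event
  | 0 => []
  | n + 1 =>
    let H := A.history u ω n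
    match accepted H with
    | some _ => H
    | none =>
      match A.act u H with
      | .generate => Sum.inl (ω (numRew H)).1 :: H
      | .verify i => Sum.inr (i, (ω i).2) :: H

/-- The run ever observes a positive label. -/
def Policy.Stops (A : Policy) (u : A.Seed) (ω : ℕ → ℝ × Bool) : Prop :=
  ∃ n, (accepted (A.history u ω n)).isSome = true

open Classical in
/-- The candidate returned by the run, if it stops. -/
noncomputable def Policy.output (A : Policy) (u : A.Seed) (ω : ℕ → ℝ × Bool) : Option ℕ :=
  if hs : A.Stops u ω then accepted (A.history u ω (Nat.find hs)) else none

open Classical in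
/-- The total cost `c_rew * N_rew + c_ver * N_ver` of the run, and `∞` if it never observes a
positive label. -/
noncomputable def Policy.cost (c_rew c_ver : ℝ) (A : Policy) (u : A.Seed)
    (ω : ℕ → ℝ × Bool) : ℝ≥0∞ :=
  if hs : A.Stops u ω then
    ENNReal.ofReal (c_rew * numRew (A.history u ω (Nat.find hs)) +
      c_ver * numVer (A.history u ω (Nat.find hs)))
  else ∞

/-- The expected cost when the stream of candidates has law `ρ` (independent of the seed). -/
noncomputable def Policy.expectedCost (c_rew c_ver : ℝ) (A : Policy)
    (ρ : Measure (ℕ → ℝ × Bool)) : ℝ≥0∞ :=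
  ∫⁻ z : A.Seed × (ℕ → ℝ × Bool), A.cost c_rew c_ver z.1 z.2 ∂(A.seedLaw.prod ρ)

/-- A sound active search policy: its decisions are measurable functions of the seed and of the
observations, and until it stops it verifies only candidates in the unverified pool.
(Every run stops only at a positive label, by the definition of a run.) -/
structure Policy.IsSound (A : Policy) : Prop where
  measurable_act : ∀ (n : ℕ) (a : Action),
    MeasurableSet {z : A.Seed × (Fin n → Event) | A.act z.1 (List.ofFn z.2) = a}
  verify_mem_pool : ∀ (u : A.Seed) (ω : ℕ → ℝ × Bool) (n i : ℕ),
    accepted (A.history u ω n) = none → A.act u (A.history u ω n) = .verify i →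
      InPool (A.history u ω n) i

/-- The optimal distribution-aware expected cost `J⋆(h, D)`: the infimum over all sound policies,
which may be chosen with knowledge of the instance. -/
noncomputable def Jstar (c_rew c_ver : ℝ) (I : SearchInstance) : ℝ≥0∞ :=
  ⨅ (A : Policy) (_ : A.IsSound),
    A.expectedCost c_rew c_ver (Measure.infinitePi fun _ : ℕ => I.pairLaw)

/-! ### The shellwise algorithm -/

/-- The shell `S_s` of pairs `(a, b)` of dyadic scales. -/
def shell (c_rew c_ver : ℝ) (s : ℕ) : Set (ℕ × ℕ) :=
  {p | p.1 ≤ p.2 ∧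
    2 ^ s * min c_rew c_ver ≤ c_rew * 2 ^ p.2 + c_ver * 2 ^ (p.2 - p.1) ∧
    c_rew * 2 ^ p.2 + c_ver * 2 ^ (p.2 - p.1) < 2 ^ (s + 1) * min c_rew c_ver}

/-- `m_s = 2 ^ (b⋆_s + 1)`, where `b⋆_s = max {b : (a, b) ∈ S_s}`; used for nonempty shells, which
are finite when the costs are positive. -/
noncomputable def genBudget (c_rew c_ver : ℝ) (s : ℕ) : ℕ :=
  2 ^ (sSup ((fun p : ℕ × ℕ => p.2) '' shell c_rew c_ver s) + 1)

/-- `k_s = 6 * 2 ^ j⋆_s`, where `j⋆_s = max {b - a : (a, b) ∈ S_s}`. -/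
noncomputable def verBudget (c_rew c_ver : ℝ) (s : ℕ) : ℕ :=
  6 * 2 ^ sSup ((fun p : ℕ × ℕ => p.2 - p.1) '' shell c_rew c_ver s)

/-- The first shell with index at least `s` that is not empty. -/
noncomputable def nextShell (c_rew c_ver : ℝ) (s : ℕ) : ℕ :=
  sInf {t | s ≤ t ∧ (shell c_rew c_ver t).Nonempty}

/-- A ranking rule lists a pool of pairs `(index, score)` by non-increasing score, with an
arbitrary (measurable) way to break ties. -/
structure IsRanking (rank : List (ℕ × ℝ) → List (ℕ × ℝ)) : Prop where
  perm : ∀ P, (rank P).Perm P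
  sorted : ∀ P, (rank P).Pairwise fun p q => q.2 ≤ p.2
  measurable : ∀ (n : ℕ) (idx : Fin n → ℕ) (l : List ℕ),
    MeasurableSet {r : Fin n → ℝ | (rank (List.ofFn fun i => (idx i, r i))).map Prod.fst = l}

/-- The internal state of the algorithm. -/
structure AdapState where
  /-- the current shell -/
  s : ℕ
  /-- number of fresh candidates still to be generated in the current shell -/
  toGen : ℕ
  /-- the candidates still to be verified in the current shell, in this order -/
  queue : List ℕ
  /-- number of candidates generated so far -/
  count : ℕ
  /-- the unverified pool of pairs `(index, score)` -/
  pool : List (ℕ × ℝ)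

/-- Enter the first nonempty shell from `s` on. -/
noncomputable def AdapState.enter (c_rew c_ver : ℝ) (s count : ℕ) (pool : List (ℕ × ℝ)) :
    AdapState where
  s := nextShell c_rew c_ver s
  toGen := genBudget c_rew c_ver (nextShell c_rew c_ver s)
  queue := []
  count := count
  pool := pool

/-- A fresh score `r` arrives and is added to the pool; after the last fresh candidate of the
shell, the pool is ranked and its top `min (k_s, |P|)` elements are queued for verification. -/
noncomputable def AdapState.onScore (c_rew c_ver : ℝ) (rank : List (ℕ × ℝ) → List (ℕ × ℝ))
    (σ : AdapState) (r : ℝ) : AdapState :=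
  let pool := (σ.count, r) :: σ.pool
  { s := σ.s
    toGen := σ.toGen - 1
    queue := if σ.toGen ≤ 1 then
        ((rank pool).take (verBudget c_rew c_ver σ.s)).map Prod.fst
      else []
    count := σ.count + 1
    pool := pool }

/-- Candidate `i` was verified: it leaves the pool and the queue; after the last verification of
the shell, the algorithm moves on to the next shell. -/
noncomputable def AdapState.onLabel (c_rew c_ver : ℝ) (σ : AdapState) (i : ℕ) : AdapState :=
  let pool := σ.pool.filter fun p => p.1 ≠ i
  match σ.queue with
  | _ :: j :: q => { σ with queue := j :: q, pool := pool }
  | _ => AdapState.enter c_rew c_ver (σ.s + 1) σ.count pool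

/-- The state of the algorithm after a history. -/
noncomputable def adapState (c_rew c_ver : ℝ) (rank : List (ℕ × ℝ) → List (ℕ × ℝ)) :
    List Event → AdapState
  | [] => AdapState.enter c_rew c_ver 0 0 []
  | Sum.inl r :: H => (adapState c_rew c_ver rank H).onScore c_rew c_ver rank r
  | Sum.inr (i, _) :: H => (adapState c_rew c_ver rank H).onLabel c_rew c_ver i

/-- The next action: verify the head of the queue during the verification phase, generate during
the generation phase (when the queue is empty). -/
def AdapState.next (σ : AdapState) : Action :=
  match σ.queue with
  | i :: _ => .verify i
  | [] => .generate

/-- The shellwise policy. It uses the two costs and no randomness of its own. -/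
noncomputable def adap (c_rew c_ver : ℝ) (rank : List (ℕ × ℝ) → List (ℕ × ℝ)) : Policy where
  Seed := Unit
  mSeed := inferInstance
  seedLaw := Measure.dirac ()
  isProb := inferInstance
  act := fun _ H => (adapState c_rew c_ver rank H).next

end ActiveSearch

/-!
The comparison with the optimal policy rests on a single number `lam`. Think of a positive label
as being worth `lam`. Verifying a candidate with score `r` then earns at most
`max (lam * h r - c_ver) 0` on average, and `lam` is chosen such that the mean of this quantity is
`c_rew`, so that generating candidates just breaks even (`exists_threshold`).

*Lower bound* (`le_Jstar`). Whether a policy ever generates candidate `i` does not depend on that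
candidate, and whether it ever verifies it does not depend on its label. Hence the expected reward
from candidate `i` is at most the expected amount spent on it (`lintegral_reward_le`). A policy
that stops almost surely collects `lam`, so it costs at least `lam`. Both independence statements
are used in the form that redrawing one coordinate of the stream does not change its law
(`lintegral_infinitePi_update`).

*Upper bound* (`exists_value_le_Jstar`). Let `T` be the set of scores with `lam * h r > c_ver`, let
`p` be its mass and `G` the probability of a positive label with score in `T`, so that
`lam * G = c_rew + c_ver * p`. Rounding gives scales `a ≤ b` with `2 ^ a ≈ 1 / p` and
`2 ^ b ≈ 1 / G` whose price is at most `4 * lam` (`exists_scales`). If `(a, b)` is in shell `s₀`,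
then `(a, b + t)` is in shell `s₀ + t`. Consider the first `2 ^ (b + t + 1)` fresh candidates of
that shell. The shell fails only if those of them with score in `T` all have negative labels, or
if there are more of these than `6 * 2 ^ (b + t - a)`, a lower bound for the number of
verifications: since the pool is ranked by score and `h` is monotone, the verified candidates are
otherwise at least as good as these (`prod_top_le_failBound`). Both events together have
probability at most `3 / 10` (`failure_le`), while prices only double from shell to shell, so the
expected cost is a convergent geometric sum (`tsum_price_le`).

The run of the policy up to acceptance coincides with its run on negative labels, which is a
function of the scores alone. So the expected cost is the expectation of a sum over time in which
step `n` has weight `∏ (1 - h (R i))` over the candidates verified before it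
(`lintegral_mul_chosen_labels_false`). An invariant of the algorithm bounds this sum by a sum over
shells for every sequence of scores (`tsum_stepCost_mul_verifiedProd_le`), and the fresh
candidates of different shells are independent (`lintegral_reachBound_le`).
-/

namespace ActiveSearch

/-! ### Resampling one coordinate of an i.i.d. stream -/

section Resampling

variable {α : Type*} [MeasurableSpace α]

lemma measurable_update_prod (i : ℕ) :
    Measurable fun z : (ℕ → α) × α => Function.update z.1 i z.2 :=
  measurable_pi_iff.2 fun j => by
    by_cases hj : j = i
    · subst hj
      simpa using measurable_snd
    · simp only [Function.update_of_ne hj]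
      fun_prop

/-- Redrawing one coordinate of an i.i.d. stream does not change its law. -/
lemma infinitePi_eq_map_update (ρ : Measure α) [IsProbabilityMeasure ρ] (i : ℕ) :
    ((Measure.infinitePi fun _ : ℕ => ρ).prod ρ).map
        (fun z : (ℕ → α) × α => Function.update z.1 i z.2) =
      Measure.infinitePi fun _ : ℕ => ρ := by
  have hupd := measurable_update_prod (α := α) i
  refine Measure.eq_infinitePi _ fun s t ht => ?_
  rw [Measure.map_apply hupd (.pi s.countable_toSet fun j _ => ht j)]
  have hpre : (fun z : (ℕ → α) × α => Function.update z.1 i z.2) ⁻¹' Set.pi s t =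
      (Set.pi (s.erase i : Finset ℕ) t) ×ˢ (if i ∈ s then t i else Set.univ) := by
    ext ⟨ω, x⟩
    simp only [Set.mem_preimage, Set.mem_pi, Finset.mem_coe, Set.mem_prod, Finset.mem_erase]
    constructor
    · refine fun H => ⟨fun j hj => by simpa [hj.1] using H j hj.2, ?_⟩
      split_ifs with hi
      · simpa using H i hi
      · trivial
    · rintro ⟨h1, h2⟩ j hj
      by_cases hji : j = i
      · subst hji
        simpa [hj] using h2
      · simpa [hji] using h1 j ⟨hji, hj⟩
  rw [hpre, Measure.prod_prod, Measure.infinitePi_pi _ fun j _ => ht j]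
  by_cases hi : i ∈ s
  · rw [if_pos hi, Finset.prod_erase_mul s (fun j => ρ (t j)) hi]
  · rw [if_neg hi, Finset.erase_eq_of_notMem hi]
    simp

lemma lintegral_infinitePi_update (ρ : Measure α) [IsProbabilityMeasure ρ] (i : ℕ)
    {F : (ℕ → α) → ℝ≥0∞} (hF : Measurable F) :
    ∫⁻ ω, F ω ∂(Measure.infinitePi fun _ : ℕ => ρ) =
      ∫⁻ ω, ∫⁻ x, F (Function.update ω i x) ∂ρ ∂(Measure.infinitePi fun _ : ℕ => ρ) := by
  have hupd := measurable_update_prod (α := α) i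
  conv_lhs => rw [← infinitePi_eq_map_update ρ i]
  rw [lintegral_map hF hupd, lintegral_prod (fun z : (ℕ → α) × α => F (Function.update z.1 i z.2))
    (hF.comp hupd).aemeasurable]

/-- A function that ignores coordinate `i` is independent of that coordinate. -/
lemma lintegral_mul_coord (ρ : Measure α) [IsProbabilityMeasure ρ] (i : ℕ)
    {F : (ℕ → α) → ℝ≥0∞} (hF : Measurable F)
    (hFi : ∀ ω x, F (Function.update ω i x) = F ω) {g : α → ℝ≥0∞} (hg : Measurable g) :
    ∫⁻ ω, F ω * g (ω i) ∂(Measure.infinitePi fun _ : ℕ => ρ) =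
      (∫⁻ ω, F ω ∂(Measure.infinitePi fun _ : ℕ => ρ)) * ∫⁻ x, g x ∂ρ := by
  have hm : Measurable fun ω : ℕ → α => F ω * g (ω i) :=
    hF.mul (hg.comp (measurable_pi_apply i))
  rw [lintegral_infinitePi_update ρ i hm]
  simp only [hFi, Function.update_self]
  simp_rw [lintegral_const_mul _ hg]
  rw [lintegral_mul_const _ hF]

lemma measurable_prod_coord {g : α → ℝ≥0∞} (hg : Measurable g) (s : Finset ℕ) :
    Measurable fun ω : ℕ → α => ∏ j ∈ s, g (ω j) :=
  Finset.measurable_prod _ fun j _ => hg.comp (measurable_pi_apply j)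

/-- The coordinates in a block are independent of each other and of the earlier ones. -/
lemma lintegral_mul_prod_block (ρ : Measure α) [IsProbabilityMeasure ρ] (c m : ℕ)
    {F : (ℕ → α) → ℝ≥0∞} (hF : Measurable F)
    (hFc : ∀ ω x i, c ≤ i → F (Function.update ω i x) = F ω) {g : α → ℝ≥0∞}
    (hg : Measurable g) :
    ∫⁻ ω, F ω * ∏ j ∈ Finset.Ico c (c + m), g (ω j) ∂(Measure.infinitePi fun _ : ℕ => ρ) =
      (∫⁻ ω, F ω ∂(Measure.infinitePi fun _ : ℕ => ρ)) * (∫⁻ x, g x ∂ρ) ^ m := by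
  induction m with
  | zero => simp
  | succ m ih =>
    have h1 : ∀ ω : ℕ → α, F ω * ∏ j ∈ Finset.Ico c (c + (m + 1)), g (ω j) =
        (F ω * ∏ j ∈ Finset.Ico c (c + m), g (ω j)) * g (ω (c + m)) := fun ω => by
      rw [← add_assoc, Finset.prod_Ico_succ_top (by omega), mul_assoc]
    simp_rw [h1]
    rw [lintegral_mul_coord ρ (c + m)
      (F := fun ω => F ω * ∏ j ∈ Finset.Ico c (c + m), g (ω j))
      (hF.mul (measurable_prod_coord hg _)) ?_ hg, ih,
      pow_succ, mul_assoc]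
    intro ω x
    rw [hFc _ _ _ (by omega)]
    congr 1
    refine Finset.prod_congr rfl fun j hj => ?_
    rw [Function.update_of_ne]
    have := (Finset.mem_Ico.1 hj).2
    omega

end Resampling

/-! ### The law of a score and its label -/

lemma SearchInstance.lintegral_pairLaw (I : SearchInstance) {F : ℝ × Bool → ℝ≥0∞}
    (hF : Measurable F) :
    ∫⁻ z, F z ∂I.pairLaw =
      ∫⁻ r, (ENNReal.ofReal (I.h r) * F (r, true) + ENNReal.ofReal (1 - I.h r) * F (r, false))
        ∂I.D := by
  have hm := I.measurable_h
  have m1 : Measurable (fun r : ℝ => (r, true)) := by fun_prop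
  have m2 : Measurable (fun r : ℝ => (r, false)) := by fun_prop
  have hm1 : Measurable fun r => ENNReal.ofReal (I.h r) := by fun_prop
  have hm2 : Measurable fun r => ENNReal.ofReal (1 - I.h r) := by fun_prop
  rw [SearchInstance.pairLaw, lintegral_add_measure, lintegral_map hF m1, lintegral_map hF m2,
    lintegral_withDensity_eq_lintegral_mul _ hm1 (g := fun r => F (r, true)) (hF.comp m1),
    lintegral_withDensity_eq_lintegral_mul _ hm2 (g := fun r => F (r, false)) (hF.comp m2),
    ← lintegral_add_left (hm1.mul (g := fun r => F (r, true)) (hF.comp m1))]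
  rfl

lemma SearchInstance.ofReal_h_add (I : SearchInstance) (r : ℝ) :
    ENNReal.ofReal (I.h r) + ENNReal.ofReal (1 - I.h r) = 1 := by
  rw [← ENNReal.ofReal_add (I.h_mem r).1 (sub_nonneg.2 (I.h_mem r).2)]
  simp

lemma SearchInstance.lintegral_pairLaw_fst (I : SearchInstance) {F : ℝ → ℝ≥0∞}
    (hF : Measurable F) : ∫⁻ z, F z.1 ∂I.pairLaw = ∫⁻ r, F r ∂I.D := by
  rw [I.lintegral_pairLaw (F := fun z => F z.1) (hF.comp measurable_fst)]
  simp_rw [← add_mul, I.ofReal_h_add, one_mul]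

/-- The law of the stream of candidates. -/
noncomputable abbrev SearchInstance.streamLaw (I : SearchInstance) : Measure (ℕ → ℝ × Bool) :=
  Measure.infinitePi fun _ : ℕ => I.pairLaw

/-- As long as the label of candidate `i` is not used, it can be replaced by its conditional
expectation given the score. -/
lemma SearchInstance.lintegral_mul_label (I : SearchInstance) (i : ℕ)
    {F : (ℕ → ℝ × Bool) → ℝ≥0∞} (hF : Measurable F)
    (hFi : ∀ ω v, F (Function.update ω i ((ω i).1, v)) = F ω) (φ : Bool → ℝ≥0∞) :
    ∫⁻ ω, F ω * φ (ω i).2 ∂I.streamLaw =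
      ∫⁻ ω, F ω * (ENNReal.ofReal (I.h (ω i).1) * φ true +
        ENNReal.ofReal (1 - I.h (ω i).1) * φ false) ∂I.streamLaw := by
  have hm := I.measurable_h
  have hφ : Measurable φ := measurable_of_countable φ
  have e1 : Measurable fun ω : ℕ → ℝ × Bool => F ω * φ (ω i).2 := by fun_prop
  have e2 : Measurable fun ω : ℕ → ℝ × Bool => F ω * (ENNReal.ofReal (I.h (ω i).1) * φ true +
        ENNReal.ofReal (1 - I.h (ω i).1) * φ false) := by fun_prop
  rw [lintegral_infinitePi_update _ i e1, lintegral_infinitePi_update _ i e2]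
  congr 1
  funext ω
  have key : ∀ r v, F (Function.update ω i (r, v)) = F (Function.update ω i (r, true)) :=
    fun r v => by simpa using hFi (Function.update ω i (r, true)) v
  have u : Measurable fun x : ℝ × Bool => Function.update ω i x :=
    measurable_update ω
  rw [I.lintegral_pairLaw (F := fun x => F (Function.update ω i x) * φ (Function.update ω i x i).2)
      (e1.comp u),
    I.lintegral_pairLaw (F := fun x => F (Function.update ω i x) *
      (ENNReal.ofReal (I.h (Function.update ω i x i).1) * φ true +
        ENNReal.ofReal (1 - I.h (Function.update ω i x i).1) * φ false)) (e2.comp u)]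
  refine lintegral_congr fun r => ?_
  simp only [Function.update_self, key r false]
  rw [← add_mul, I.ofReal_h_add, one_mul]
  ring

/-! ### Measurability of runs -/

section Fiber

variable {X β : Type*} [MeasurableSpace X] [Countable β]

/-- A condition whose form depends on a countably valued measurable quantity is measurable. -/
lemma measurableSet_of_fiber {f : X → β} (hf : ∀ b, MeasurableSet {x | f x = b})
    {Q : β → X → Prop} (hQ : ∀ b, MeasurableSet {x | Q b x}) :
    MeasurableSet {x | Q (f x) x} := by
  have h : {x | Q (f x) x} = ⋃ b, {x | f x = b} ∩ {x | Q b x} := by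
    ext x
    simp
  rw [h]
  exact MeasurableSet.iUnion fun b => (hf b).inter (hQ b)

lemma measurableSet_fiber_comp {f : X → β} (hf : ∀ b, MeasurableSet {x | f x = b})
    (P : β → Prop) : MeasurableSet {x | P (f x)} :=
  measurableSet_of_fiber hf (Q := fun b _ => P b) fun _ => MeasurableSet.const _

lemma measurable_of_fiber {γ : Type*} [MeasurableSpace γ] {f : X → β}
    (hf : ∀ b, MeasurableSet {x | f x = b}) {G : β → X → γ} (hG : ∀ b, Measurable (G b)) :
    Measurable fun x => G (f x) x := fun _ hs =>
  measurableSet_of_fiber hf (Q := fun b x => G b x ∈ _) fun b => hG b hs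

end Fiber

/-- The discrete part of an event: everything except the value of a score. -/
abbrev Shape := Option (ℕ × Bool)

/-- The discrete part of a history. -/
def shapes (H : List Event) : List Shape := H.map Sum.getRight?

/-- The history with a given discrete part in which the scores are those of the stream `ω`. -/
def fill (ω : ℕ → ℝ × Bool) : List Shape → List Event
  | [] => []
  | none :: l => Sum.inl (ω (l.countP Option.isNone)).1 :: fill ω l
  | some x :: l => Sum.inr x :: fill ω l

/-- `accepted` in terms of the discrete part of the history. -/
def acceptedShape : List Shape → Option ℕ
  | some (i, true) :: _ => some i
  | _ => none

/-- The candidates verified in a history, newest first. -/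
def verified (H : List Event) : List ℕ := (shapes H).filterMap (Option.map Prod.fst)

/-- The discrete part of a history after one more action. -/
def nextShape (ω : ℕ → ℝ × Bool) (l : List Shape) (a : Action) : List Shape :=
  match acceptedShape l with
  | some _ => l
  | none =>
    match a with
    | .generate => none :: l
    | .verify i => some (i, (ω i).2) :: l

lemma accepted_eq_acceptedShape (H : List Event) : accepted H = acceptedShape (shapes H) := by
  match H with
  | [] => rfl
  | Sum.inl r :: H => rfl
  | Sum.inr (i, true) :: H => rfl
  | Sum.inr (i, false) :: H => rfl

lemma numRew_eq_countP_shapes (H : List Event) :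
    numRew H = (shapes H).countP Option.isNone := by
  induction H with
  | nil => rfl
  | cons e H ih =>
    rcases e with r | x <;> simp_all [numRew, shapes, List.countP_cons]

instance : Countable Action := by
  have : Function.Injective fun a : Action =>
      match a with
      | .generate => (none : Option ℕ)
      | .verify i => some i := by
    rintro (_ | i) (_ | j) h <;> simp_all
  exact this.countable

section History

variable (A : Policy) (u : A.Seed) (ω : ℕ → ℝ × Bool)

lemma history_succ_of_accepted {n : ℕ} (h : accepted (A.history u ω n) ≠ none) :
    A.history u ω (n + 1) = A.history u ω n := by
  obtain ⟨i, hi⟩ := Option.ne_none_iff_exists'.1 h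
  simp [Policy.history, hi]

lemma history_succ_generate {n : ℕ} (h : accepted (A.history u ω n) = none)
    (ha : A.act u (A.history u ω n) = .generate) :
    A.history u ω (n + 1) =
      Sum.inl (ω (numRew (A.history u ω n))).1 :: A.history u ω n := by
  simp [Policy.history, h, ha]

lemma history_succ_verify {n i : ℕ} (h : accepted (A.history u ω n) = none)
    (ha : A.act u (A.history u ω n) = .verify i) :
    A.history u ω (n + 1) = Sum.inr (i, (ω i).2) :: A.history u ω n := by
  simp [Policy.history, h, ha]

/-- Case distinction on one step of a run. -/
lemma history_succ_cases (n : ℕ) :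
    (accepted (A.history u ω n) ≠ none ∧ A.history u ω (n + 1) = A.history u ω n) ∨
    (accepted (A.history u ω n) = none ∧ A.act u (A.history u ω n) = .generate ∧
      A.history u ω (n + 1) =
        Sum.inl (ω (numRew (A.history u ω n))).1 :: A.history u ω n) ∨
    (accepted (A.history u ω n) = none ∧ ∃ i, A.act u (A.history u ω n) = .verify i ∧
      A.history u ω (n + 1) = Sum.inr (i, (ω i).2) :: A.history u ω n) := by
  by_cases h : accepted (A.history u ω n) = none
  · rcases ha : A.act u (A.history u ω n) with _ | i
    · exact .inr (.inl ⟨h, rfl, history_succ_generate A u ω h ha⟩)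
    · exact .inr (.inr ⟨h, i, rfl, history_succ_verify A u ω h ha⟩)
  · exact .inl ⟨h, history_succ_of_accepted A u ω h⟩

lemma history_eq_fill (n : ℕ) :
    A.history u ω n = fill ω (shapes (A.history u ω n)) := by
  induction n with
  | zero => rfl
  | succ n ih =>
    rcases history_succ_cases A u ω n with ⟨-, h⟩ | ⟨-, -, h⟩ | ⟨-, i, -, h⟩
    · rw [h]
      exact ih
    · rw [h]
      change _ = fill ω (none :: shapes (A.history u ω n))
      rw [fill, ← ih, numRew_eq_countP_shapes]
    · rw [h]
      change _ = fill ω (some (i, (ω i).2) :: shapes (A.history u ω n))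
      rw [fill, ← ih]

lemma shapes_history_succ (n : ℕ) :
    shapes (A.history u ω (n + 1)) =
      nextShape ω (shapes (A.history u ω n))
        (A.act u (fill ω (shapes (A.history u ω n)))) := by
  rw [← history_eq_fill]
  unfold nextShape
  rw [← accepted_eq_acceptedShape]
  rcases history_succ_cases A u ω n with ⟨h', h⟩ | ⟨h', h'', h⟩ | ⟨h', i, h'', h⟩
  · obtain ⟨i, hi⟩ := Option.ne_none_iff_exists'.1 h'
    rw [h, hi]
  · rw [h, h', h'']
    rfl
  · rw [h, h', h'']
    rfl

lemma history_suffix {n m : ℕ} (h : n ≤ m) : A.history u ω n <:+ A.history u ω m := by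
  induction m, h using Nat.le_induction with
  | base => exact List.suffix_rfl
  | succ m _ ih =>
    rcases history_succ_cases A u ω m with ⟨-, h⟩ | ⟨-, -, h⟩ | ⟨-, i, -, h⟩
    · rwa [h]
    · rw [h]
      exact ih.trans (List.suffix_cons _ _)
    · rw [h]
      exact ih.trans (List.suffix_cons _ _)

lemma history_eq_of_accepted {n m : ℕ} (hn : accepted (A.history u ω n) ≠ none) (h : n ≤ m) :
    A.history u ω m = A.history u ω n := by
  induction m, h using Nat.le_induction with
  | base => rfl
  | succ m _ ih => rw [history_succ_of_accepted A u ω (by rwa [ih]), ih]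

lemma label_of_mem_history {n i : ℕ} {v : Bool} (h : Sum.inr (i, v) ∈ A.history u ω n) :
    v = (ω i).2 := by
  induction n with
  | zero => simp [Policy.history] at h
  | succ n ih =>
    rcases history_succ_cases A u ω n with ⟨-, h'⟩ | ⟨-, -, h'⟩ | ⟨-, j, -, h'⟩
    · exact ih (h' ▸ h)
    · rw [h'] at h
      exact ih (by simpa using h)
    · rw [h', List.mem_cons] at h
      rcases h with h | h
      · simp only [Sum.inr.injEq, Prod.mk.injEq] at h
        rw [h.2, h.1]
      · exact ih h

lemma mem_of_accepted {H : List Event} {i : ℕ} (h : accepted H = some i) :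
    Sum.inr (i, true) ∈ H := by
  match H with
  | [] => simp [accepted] at h
  | Sum.inl r :: H => simp [accepted] at h
  | Sum.inr (i, true) :: H => simp_all [accepted]
  | Sum.inr (i, false) :: H => simp [accepted] at h

lemma mem_verified_iff {H : List Event} {i : ℕ} :
    i ∈ verified H ↔ ∃ v, Sum.inr (i, v) ∈ H := by
  simp only [verified, shapes, List.mem_filterMap, List.mem_map, Option.map_eq_some_iff]
  constructor
  · rintro ⟨_, ⟨e, he, rfl⟩, ⟨j, v⟩, h, rfl⟩
    rw [Sum.getRight?_eq_some_iff] at h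
    exact ⟨v, h ▸ he⟩
  · rintro ⟨v, hv⟩
    exact ⟨_, ⟨_, hv, rfl⟩, (i, v), rfl, rfl⟩

@[simp] lemma verified_cons_inl (r : ℝ) (H : List Event) :
    verified (Sum.inl r :: H) = verified H := rfl

@[simp] lemma verified_cons_inr (x : ℕ × Bool) (H : List Event) :
    verified (Sum.inr x :: H) = x.1 :: verified H := rfl

@[simp] lemma numRew_cons_inl (r : ℝ) (H : List Event) :
    numRew (Sum.inl r :: H) = numRew H + 1 := by simp [numRew, List.countP_cons]

@[simp] lemma numRew_cons_inr (x : ℕ × Bool) (H : List Event) :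
    numRew (Sum.inr x :: H) = numRew H := by simp [numRew]

@[simp] lemma numVer_cons_inl (r : ℝ) (H : List Event) :
    numVer (Sum.inl r :: H) = numVer H := by simp [numVer]

@[simp] lemma numVer_cons_inr (x : ℕ × Bool) (H : List Event) :
    numVer (Sum.inr x :: H) = numVer H + 1 := by simp [numVer, List.countP_cons]

lemma length_verified (H : List Event) : (verified H).length = numVer H := by
  induction H with
  | nil => rfl
  | cons e H ih => rcases e with r | x <;> simp [ih]

end History

/-- For a fixed discrete part, the history is a measurable function of the stream. -/
lemma exists_measurable_ofFn_eq_fill (l : List Shape) :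
    ∃ g : (ℕ → ℝ × Bool) → Fin l.length → Event,
      Measurable g ∧ ∀ ω, List.ofFn (g ω) = fill ω l := by
  induction l with
  | nil => exact ⟨fun _ => Fin.elim0, by fun_prop, fun ω => by simp [fill]⟩
  | cons s l ih =>
    obtain ⟨g, hg, hgl⟩ := ih
    have key : ∀ e : (ℕ → ℝ × Bool) → Event, Measurable e →
        Measurable fun ω => (Fin.cons (e ω) (g ω) : Fin (l.length + 1) → Event) := by
      intro e he
      refine measurable_pi_iff.2 fun k => ?_
      refine Fin.cases ?_ (fun k => ?_) k
      · simpa using he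
      · simpa only [Fin.cons_succ] using measurable_pi_iff.1 hg k
    rcases s with _ | x
    · refine ⟨fun ω => Fin.cons (Sum.inl (ω (l.countP Option.isNone)).1) (g ω),
        key _ (measurable_inl.comp (measurable_fst.comp (measurable_pi_apply _))), fun ω => ?_⟩
      rw [fill, ← hgl]
      simp [List.ofFn_succ]
    · refine ⟨fun ω => Fin.cons (Sum.inr x) (g ω), key _ measurable_const, fun ω => ?_⟩
      rw [fill, ← hgl]
      simp [List.ofFn_succ]

lemma measurableSet_act_fill (A : Policy)
    (hA : ∀ (n : ℕ) (a : Action),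
      MeasurableSet {z : A.Seed × (Fin n → Event) | A.act z.1 (List.ofFn z.2) = a})
    (l : List Shape) (a : Action) :
    MeasurableSet {z : A.Seed × (ℕ → ℝ × Bool) | A.act z.1 (fill z.2 l) = a} := by
  obtain ⟨g, hg, hgl⟩ := exists_measurable_ofFn_eq_fill l
  have hm : Measurable fun z : A.Seed × (ℕ → ℝ × Bool) => (z.1, g z.2) :=
    measurable_fst.prodMk (hg.comp measurable_snd)
  have := hm (hA l.length a)
  simpa [Set.preimage, hgl] using this

/-- The discrete part of the history is a measurable function of the seed and the stream. -/
lemma measurableSet_shapes_history (A : Policy)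
    (hA : ∀ (n : ℕ) (a : Action),
      MeasurableSet {z : A.Seed × (Fin n → Event) | A.act z.1 (List.ofFn z.2) = a})
    (n : ℕ) (l : List Shape) :
    MeasurableSet {z : A.Seed × (ℕ → ℝ × Bool) | shapes (A.history z.1 z.2 n) = l} := by
  induction n generalizing l with
  | zero => exact MeasurableSet.const ([] = l)
  | succ n ih =>
    simp_rw [shapes_history_succ]
    refine measurableSet_of_fiber (f := fun z : A.Seed × (ℕ → ℝ × Bool) => shapes (A.history z.1 z.2 n)) ih
      (Q := fun l' (z : A.Seed × (ℕ → ℝ × Bool)) => nextShape z.2 l' (A.act z.1 (fill z.2 l')) = l) fun l' => ?_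
    refine measurableSet_of_fiber (f := fun z : A.Seed × (ℕ → ℝ × Bool) => A.act z.1 (fill z.2 l'))
      (measurableSet_act_fill A hA l') (Q := fun a (z : A.Seed × (ℕ → ℝ × Bool)) => nextShape z.2 l' a = l) fun a => ?_
    unfold nextShape
    cases acceptedShape l' with
    | some _ => exact MeasurableSet.const (l' = l)
    | none =>
      cases a with
      | generate => exact MeasurableSet.const (none :: l' = l)
      | verify i =>
        have hv : ∀ v : Bool, MeasurableSet
            {z : A.Seed × (ℕ → ℝ × Bool) | (z.2 i).2 = v} := fun v =>
          (measurable_snd.comp ((measurable_pi_apply i).comp measurable_snd))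
            (measurableSet_singleton v)
        exact measurableSet_fiber_comp hv fun v => some (i, v) :: l' = l

lemma measurableSet_history_of_shapes (A : Policy)
    (hA : ∀ (n : ℕ) (a : Action),
      MeasurableSet {z : A.Seed × (Fin n → Event) | A.act z.1 (List.ofFn z.2) = a})
    (n : ℕ) (P : List Shape → Prop) :
    MeasurableSet {z : A.Seed × (ℕ → ℝ × Bool) | P (shapes (A.history z.1 z.2 n))} :=
  measurableSet_fiber_comp (measurableSet_shapes_history A hA n) P

lemma measurableSet_act_history (A : Policy)
    (hA : ∀ (n : ℕ) (a : Action),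
      MeasurableSet {z : A.Seed × (Fin n → Event) | A.act z.1 (List.ofFn z.2) = a})
    (n : ℕ) (a : Action) :
    MeasurableSet {z : A.Seed × (ℕ → ℝ × Bool) | A.act z.1 (A.history z.1 z.2 n) = a} := by
  have h : ∀ z : A.Seed × (ℕ → ℝ × Bool), A.act z.1 (A.history z.1 z.2 n) =
      A.act z.1 (fill z.2 (shapes (A.history z.1 z.2 n))) := fun z => by
    rw [← history_eq_fill]
  simp_rw [h]
  exact measurableSet_of_fiber (f := fun z : A.Seed × (ℕ → ℝ × Bool) => shapes (A.history z.1 z.2 n))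
    (measurableSet_shapes_history A hA n) (Q := fun l (z : A.Seed × (ℕ → ℝ × Bool)) => A.act z.1 (fill z.2 l) = a)
    fun l => measurableSet_act_fill A hA l a

/-! ### Costs and stopping -/

section Cost

variable (A : Policy) (u : A.Seed) (ω : ℕ → ℝ × Bool)

lemma stops_iff : A.Stops u ω ↔ ∃ n, accepted (A.history u ω n) ≠ none := by
  simp [Policy.Stops, Option.isSome_iff_ne_none]

lemma output_eq_none_iff : A.output u ω = none ↔ ¬ A.Stops u ω := by
  classical
  unfold Policy.output
  split_ifs with hs
  · have := Nat.find_spec hs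
    simp only [hs, not_true_eq_false, iff_false]
    exact Option.isSome_iff_ne_none.1 this
  · simp [hs]

lemma label_of_output {i : ℕ} (h : A.output u ω = some i) : (ω i).2 = true := by
  classical
  unfold Policy.output at h
  split_ifs at h with hs
  exact (label_of_mem_history A u ω (mem_of_accepted h)).symm

/-- The price of an action. -/
noncomputable def stepCost (c_rew c_ver : ℝ) : Action → ℝ≥0∞
  | .generate => ENNReal.ofReal c_rew
  | .verify _ => ENNReal.ofReal c_ver

variable {c_rew c_ver : ℝ}

lemma sum_stepCost (hrew : 0 ≤ c_rew) (hver : 0 ≤ c_ver) (n : ℕ)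
    (hn : ∀ k < n, accepted (A.history u ω k) = none) :
    ENNReal.ofReal (c_rew * numRew (A.history u ω n) + c_ver * numVer (A.history u ω n)) =
      ∑ k ∈ Finset.range n, stepCost c_rew c_ver (A.act u (A.history u ω k)) := by
  induction n with
  | zero => simp [Policy.history, numRew, numVer]
  | succ n ih =>
    rw [Finset.sum_range_succ, ← ih fun k hk => hn k (by omega)]
    rcases history_succ_cases A u ω n with ⟨h', h⟩ | ⟨h', h'', h⟩ | ⟨h', i, h'', h⟩
    · exact absurd (hn n (by omega)) h'
    · rw [h, h'', stepCost, ← ENNReal.ofReal_add (by positivity) hrew]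
      congr 1
      simp
      ring
    · rw [h, h'', stepCost, ← ENNReal.ofReal_add (by positivity) hver]
      congr 1
      simp
      ring

open Classical in
/-- The cost of a run is the sum of the prices of the actions taken before acceptance; since
each action has at least a fixed positive price, this includes runs that never stop. -/
lemma cost_eq_tsum (hrew : 0 < c_rew) (hver : 0 < c_ver) :
    A.cost c_rew c_ver u ω = ∑' n, if accepted (A.history u ω n) = none then
      stepCost c_rew c_ver (A.act u (A.history u ω n)) else 0 := by
  unfold Policy.cost
  split_ifs with hs
  · have hlt : ∀ k < Nat.find hs, accepted (A.history u ω k) = none := fun k hk => by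
      simpa using Nat.find_min hs hk
    have hge : ∀ k, Nat.find hs ≤ k → accepted (A.history u ω k) ≠ none := fun k hk => by
      have := Option.isSome_iff_ne_none.1 (Nat.find_spec hs)
      rwa [history_eq_of_accepted A u ω this hk]
    rw [sum_stepCost A u ω hrew.le hver.le _ hlt, tsum_eq_sum (s := Finset.range (Nat.find hs))]
    · exact Finset.sum_congr rfl fun k hk => by rw [if_pos (hlt k (Finset.mem_range.1 hk))]
    · intro k hk
      rw [if_neg (hge k (by simpa using hk))]
  · rw [stops_iff] at hs
    push Not at hs
    symm
    rw [← top_le_iff]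
    have hc : ENNReal.ofReal (min c_rew c_ver) ≠ 0 := by
      simpa using ⟨hrew, hver⟩
    calc (⊤ : ℝ≥0∞) = ∑' _ : ℕ, ENNReal.ofReal (min c_rew c_ver) :=
          (ENNReal.tsum_const_eq_top_of_ne_zero hc).symm
      _ ≤ _ := ENNReal.tsum_le_tsum fun n => by
          rw [if_pos (hs n)]
          cases A.act u (A.history u ω n)
          · exact ENNReal.ofReal_le_ofReal (min_le_left _ _)
          · exact ENNReal.ofReal_le_ofReal (min_le_right _ _)

lemma Policy.IsSound.measurable_cost {A : Policy} (hA : A.IsSound) (hrew : 0 < c_rew)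
    (hver : 0 < c_ver) :
    Measurable fun z : A.Seed × (ℕ → ℝ × Bool) => A.cost c_rew c_ver z.1 z.2 := by
  classical
  have h : ∀ n, Measurable fun z : A.Seed × (ℕ → ℝ × Bool) =>
      if accepted (A.history z.1 z.2 n) = none then
        stepCost c_rew c_ver (A.act z.1 (A.history z.1 z.2 n)) else 0 := fun n => by
    refine Measurable.ite ?_ ?_ measurable_const
    · simp_rw [accepted_eq_acceptedShape]
      exact measurableSet_history_of_shapes A hA.measurable_act n fun l => acceptedShape l = none
    · exact measurable_of_fiber (f := fun z : A.Seed × (ℕ → ℝ × Bool) =>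
        A.act z.1 (A.history z.1 z.2 n)) (measurableSet_act_history A hA.measurable_act n)
        (G := fun a _ => stepCost c_rew c_ver a) fun _ => measurable_const
  simp_rw [cost_eq_tsum A _ _ hrew hver]
  exact Measurable.tsum fun n => by convert h n

end Cost

/-! ### The run in which all labels are negative -/

section NoStop

variable (A : Policy) (u : A.Seed)

/-- The stream with given scores in which all labels are negative. -/
def negStream (R : ℕ → ℝ) : ℕ → ℝ × Bool := fun j => (R j, false)

lemma measurable_negStream : Measurable negStream :=
  measurable_pi_iff.2 fun j => (measurable_pi_apply j).prodMk measurable_const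

lemma accepted_history_negStream (R : ℕ → ℝ) (n : ℕ) :
    accepted (A.history u (negStream R) n) = none := by
  rw [Option.eq_none_iff_forall_not_mem]
  intro i hi
  simpa [negStream] using label_of_mem_history A u _ (mem_of_accepted hi)

/-- A run agrees with the run on negative labels as long as no label that it has seen is
positive, and it has accepted a candidate otherwise. -/
lemma history_eq_negStream (ω : ℕ → ℝ × Bool) (n : ℕ) :
    ((∀ i ∈ verified (A.history u (negStream fun j => (ω j).1) n), (ω i).2 = false) ∧
      A.history u ω n = A.history u (negStream fun j => (ω j).1) n) ∨
    ((¬ ∀ i ∈ verified (A.history u (negStream fun j => (ω j).1) n), (ω i).2 = false) ∧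
      accepted (A.history u ω n) ≠ none) := by
  induction n with
  | zero => simp [Policy.history, verified, shapes]
  | succ n ih =>
    have hacc := accepted_history_negStream A u (fun j => (ω j).1) n
    -- while the histories are equal, both runs choose the same action
    rcases ih with ⟨h1, h2⟩ | ⟨h1, h2⟩
    · rcases history_succ_cases A u (negStream fun j => (ω j).1) n with
        ⟨h', -⟩ | ⟨-, ha, h⟩ | ⟨-, i, ha, h⟩
      · exact absurd hacc h'
      · rw [h, history_succ_generate A u ω (h2 ▸ hacc) (h2 ▸ ha), h2]
        exact .inl ⟨h1, rfl⟩
      · rw [h, history_succ_verify A u ω (h2 ▸ hacc) (h2 ▸ ha), h2]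
        rcases hv : (ω i).2 with _ | _
        · refine .inl ⟨?_, rfl⟩
          simpa [hv] using h1
        · refine .inr ⟨?_, by simp [accepted]⟩
          simp [hv]
    · refine .inr ⟨fun h => h1 fun i hi => h i ?_, ?_⟩
      · obtain ⟨v, hv⟩ := mem_verified_iff.1 hi
        exact mem_verified_iff.2 ⟨v, (history_suffix A u _ n.le_succ).mem hv⟩
      · rwa [history_succ_of_accepted A u ω h2]

open Classical in
lemma cost_eq_tsum_negStream {c_rew c_ver : ℝ} (hrew : 0 < c_rew) (hver : 0 < c_ver)
    (ω : ℕ → ℝ × Bool) :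
    A.cost c_rew c_ver u ω =
      ∑' n, stepCost c_rew c_ver (A.act u (A.history u (negStream fun j => (ω j).1) n)) *
        if ∀ i ∈ verified (A.history u (negStream fun j => (ω j).1) n), (ω i).2 = false
          then 1 else 0 := by
  rw [cost_eq_tsum A u ω hrew hver]
  congr 1
  funext n
  rcases history_eq_negStream A u ω n with ⟨h1, h2⟩ | ⟨h1, h2⟩
  · rw [if_pos h1, h2, if_pos (accepted_history_negStream A u _ n), mul_one]
  · rw [if_neg h1, if_neg h2, mul_zero]

end NoStop

/-! ### The lower bound on the cost of every sound policy -/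

section LowerBound

variable {A : Policy} (hA : A.IsSound) (u : A.Seed)

/-- Candidate `i` is generated at some time. -/
def EverGenerated (A : Policy) (u : A.Seed) (ω : ℕ → ℝ × Bool) (i : ℕ) : Prop :=
  ∃ n, i < numRew (A.history u ω n)

/-- Candidate `i` is verified at some time. -/
def EverVerified (A : Policy) (u : A.Seed) (ω : ℕ → ℝ × Bool) (i : ℕ) : Prop :=
  ∃ n, i ∈ verified (A.history u ω n)

lemma numRew_history_mono (A : Policy) (u : A.Seed) (ω : ℕ → ℝ × Bool) {n m : ℕ} (h : n ≤ m) :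
    numRew (A.history u ω n) ≤ numRew (A.history u ω m) :=
  (history_suffix A u ω h).sublist.countP_le

lemma verified_history_mono (A : Policy) (u : A.Seed) (ω : ℕ → ℝ × Bool) {n m : ℕ} (h : n ≤ m)
    {i : ℕ} (hi : i ∈ verified (A.history u ω n)) : i ∈ verified (A.history u ω m) := by
  obtain ⟨v, hv⟩ := mem_verified_iff.1 hi
  exact mem_verified_iff.2 ⟨v, (history_suffix A u _ h).mem hv⟩

include hA in
lemma EverVerified.everGenerated {ω : ℕ → ℝ × Bool} {i : ℕ} (h : EverVerified A u ω i) :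
    EverGenerated A u ω i := by
  obtain ⟨n, hn⟩ := h
  induction n with
  | zero => simp [Policy.history, verified, shapes] at hn
  | succ n ih =>
    rcases history_succ_cases A u ω n with ⟨-, h⟩ | ⟨-, -, h⟩ | ⟨h', j, ha, h⟩
    · exact ih (h ▸ hn)
    · exact ih (by simpa [h] using hn)
    · rw [h, verified_cons_inr, List.mem_cons] at hn
      rcases hn with rfl | hn
      · exact ⟨n, (hA.verify_mem_pool u ω n _ h' ha).1⟩
      · exact ih hn

include hA in
/-- Until candidate `i` is generated, a run does not depend on it. -/
lemma history_eq_or_generated {ω ω' : ℕ → ℝ × Bool} {i : ℕ} (h : ∀ j ≠ i, ω' j = ω j) (n : ℕ) :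
    A.history u ω' n = A.history u ω n ∨
      (i < numRew (A.history u ω n) ∧ i < numRew (A.history u ω' n)) := by
  induction n with
  | zero => exact .inl rfl
  | succ n ih =>
    rcases ih with ih | ⟨h1, h2⟩
    · rcases history_succ_cases A u ω n with ⟨h', e⟩ | ⟨h', ha, e⟩ | ⟨h', j, ha, e⟩
      · rw [history_succ_of_accepted A u ω' (by rwa [ih]), e]
        exact .inl ih
      · rw [history_succ_generate A u ω' (by rwa [ih]) (by rwa [ih]), e, ih]
        by_cases hi : numRew (A.history u ω n) = i
        · exact .inr (by simp [hi])
        · exact .inl (by rw [h _ hi])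
      · rw [history_succ_verify A u ω' (by rwa [ih]) (by rwa [ih]), e, ih]
        by_cases hi : j = i
        · have := (hA.verify_mem_pool u ω n j h' ha).1
          exact .inr (by simpa [← hi] using this)
        · exact .inl (by rw [h _ hi])
    · exact .inr ⟨h1.trans_le (numRew_history_mono A u ω n.le_succ),
        h2.trans_le (numRew_history_mono A u ω' n.le_succ)⟩

/-- Until candidate `i` is verified, a run does not depend on its label. -/
lemma history_eq_or_verified (A : Policy) (u : A.Seed) {ω ω' : ℕ → ℝ × Bool} {i : ℕ}
    (h : ∀ j ≠ i, ω' j = ω j) (hi : (ω' i).1 = (ω i).1) (n : ℕ) :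
    A.history u ω' n = A.history u ω n ∨
      (i ∈ verified (A.history u ω n) ∧ i ∈ verified (A.history u ω' n)) := by
  have hfst : ∀ j, (ω' j).1 = (ω j).1 := fun j => by
    by_cases hj : j = i
    · rw [hj, hi]
    · rw [h j hj]
  induction n with
  | zero => exact .inl rfl
  | succ n ih =>
    rcases ih with ih | ⟨h1, h2⟩
    · rcases history_succ_cases A u ω n with ⟨h', e⟩ | ⟨h', ha, e⟩ | ⟨h', j, ha, e⟩
      · rw [history_succ_of_accepted A u ω' (by rwa [ih]), e]
        exact .inl ih
      · rw [history_succ_generate A u ω' (by rwa [ih]) (by rwa [ih]), e, ih]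
        exact .inl (by rw [hfst])
      · rw [history_succ_verify A u ω' (by rwa [ih]) (by rwa [ih]), e, ih]
        by_cases hi : j = i
        · exact .inr (by simp [hi])
        · exact .inl (by rw [h _ hi])
    · exact .inr ⟨verified_history_mono A u ω n.le_succ h1,
        verified_history_mono A u ω' n.le_succ h2⟩

include hA in
lemma everGenerated_update (ω : ℕ → ℝ × Bool) (i : ℕ) (x : ℝ × Bool) :
    EverGenerated A u (Function.update ω i x) i ↔ EverGenerated A u ω i := by
  refine exists_congr fun n => ?_
  rcases history_eq_or_generated hA u (ω := ω) (ω' := Function.update ω i x) (i := i)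
    (fun j hj => Function.update_of_ne hj _ _) n with h | h
  · rw [h]
  · exact iff_of_true h.2 h.1

lemma everVerified_update (A : Policy) (u : A.Seed) (ω : ℕ → ℝ × Bool) (i : ℕ) (v : Bool) :
    EverVerified A u (Function.update ω i ((ω i).1, v)) i ↔ EverVerified A u ω i := by
  refine exists_congr fun n => ?_
  rcases history_eq_or_verified A u (ω := ω) (ω' := Function.update ω i ((ω i).1, v)) (i := i)
    (fun j hj => Function.update_of_ne hj _ _) (by simp) n with h | h
  · rw [h]
  · exact iff_of_true h.2 h.1

include hA in
lemma measurableSet_everGenerated (i : ℕ) :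
    MeasurableSet {z : A.Seed × (ℕ → ℝ × Bool) | EverGenerated A z.1 z.2 i} := by
  simp only [EverGenerated, Set.ofPred_exists, numRew_eq_countP_shapes]
  exact MeasurableSet.iUnion fun n => measurableSet_history_of_shapes A hA.measurable_act n
    fun l => i < l.countP Option.isNone

include hA in
lemma measurableSet_everVerified (i : ℕ) :
    MeasurableSet {z : A.Seed × (ℕ → ℝ × Bool) | EverVerified A z.1 z.2 i} := by
  simp only [EverVerified, Set.ofPred_exists, verified]
  exact MeasurableSet.iUnion fun n => measurableSet_history_of_shapes A hA.measurable_act n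
    fun l => i ∈ l.filterMap (Option.map Prod.fst)

include hA in
lemma measurableSet_stops :
    MeasurableSet {z : A.Seed × (ℕ → ℝ × Bool) | A.Stops z.1 z.2} := by
  simp only [stops_iff, Set.ofPred_exists, accepted_eq_acceptedShape]
  exact MeasurableSet.iUnion fun n => measurableSet_history_of_shapes A hA.measurable_act n
    fun l => acceptedShape l ≠ none

open Classical in
/-- The cost of a run, accounted for candidate by candidate; infinite if the run never stops. -/
noncomputable def candidateCost (c_rew c_ver : ℝ) (A : Policy) (u : A.Seed)
    (ω : ℕ → ℝ × Bool) : ℝ≥0∞ :=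
  (∑' i, (ENNReal.ofReal c_rew * (if EverGenerated A u ω i then 1 else 0) +
    ENNReal.ofReal c_ver * (if EverVerified A u ω i then 1 else 0))) +
    if A.Stops u ω then 0 else ⊤

variable {c_rew c_ver : ℝ}

lemma tsum_ite_le_of_mem_finset (s : Finset ℕ) (P : ℕ → Prop) [DecidablePred P]
    (hP : ∀ i, P i → i ∈ s) : (∑' i, if P i then (1 : ℝ≥0∞) else 0) ≤ s.card := by
  rw [tsum_eq_sum (s := s) fun i hi => if_neg fun h => hi (hP i h)]
  calc (∑ i ∈ s, if P i then (1 : ℝ≥0∞) else 0) ≤ ∑ i ∈ s, 1 :=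
        Finset.sum_le_sum fun i _ => by split_ifs <;> simp
    _ = s.card := by simp

lemma candidateCost_le_cost (hrew : 0 ≤ c_rew) (hver : 0 ≤ c_ver) (A : Policy) (u : A.Seed)
    (ω : ℕ → ℝ × Bool) : candidateCost c_rew c_ver A u ω ≤ A.cost c_rew c_ver u ω := by
  classical
  unfold candidateCost Policy.cost
  split_ifs with hs
  · set N := Nat.find hs
    have hN : accepted (A.history u ω N) ≠ none :=
      Option.isSome_iff_ne_none.1 (Nat.find_spec hs)
    have hmax : ∀ n, A.history u ω n <:+ A.history u ω N := fun n => by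
      rcases le_total n N with h | h
      · exact history_suffix A u ω h
      · rw [history_eq_of_accepted A u ω hN h]
    rw [add_zero, ENNReal.tsum_add, ENNReal.tsum_mul_left, ENNReal.tsum_mul_left,
      ENNReal.ofReal_add (by positivity) (by positivity), ENNReal.ofReal_mul hrew,
      ENNReal.ofReal_mul hver, ENNReal.ofReal_natCast, ENNReal.ofReal_natCast]
    gcongr
    · refine (tsum_ite_le_of_mem_finset (Finset.range (numRew (A.history u ω N))) _ ?_).trans_eq
        (by rw [Finset.card_range])
      rintro i ⟨n, hn⟩
      exact Finset.mem_range.2 (hn.trans_le (hmax n).sublist.countP_le)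
    · refine (tsum_ite_le_of_mem_finset (verified (A.history u ω N)).toFinset _ ?_).trans ?_
      · rintro i ⟨n, hn⟩
        obtain ⟨v, hv⟩ := mem_verified_iff.1 hn
        exact List.mem_toFinset.2 (mem_verified_iff.2 ⟨v, (hmax n).mem hv⟩)
      · exact_mod_cast (List.toFinset_card_le _).trans (length_verified _).le
  · exact le_top

include hA in
lemma measurable_candidateCost : Measurable fun z : A.Seed × (ℕ → ℝ × Bool) =>
    candidateCost c_rew c_ver A z.1 z.2 := by
  unfold candidateCost
  refine Measurable.add (Measurable.tsum fun i => ?_) ?_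
  · exact ((Measurable.ite (measurableSet_everGenerated hA i) measurable_const
      measurable_const).const_mul _).add ((Measurable.ite (measurableSet_everVerified hA i)
        measurable_const measurable_const).const_mul _)
  · exact Measurable.ite (measurableSet_stops hA) measurable_const measurable_const

open Classical in
include hA in
/-- The expected reward from verifying candidate `i`, when a positive label is worth `lam`, does
not exceed the expected amount spent on that candidate, provided that even the option to verify
a fresh candidate only if this is profitable is not worth its generation. -/
lemma lintegral_reward_le (I : SearchInstance) {lam : ℝ} (hlam : 0 ≤ lam)
    (hw : ∫⁻ r, ENNReal.ofReal (lam * I.h r - c_ver) ∂I.D ≤ ENNReal.ofReal c_rew) (i : ℕ) :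
    ∫⁻ ω, (if EverVerified A u ω i then 1 else 0) *
        (if (ω i).2 = true then ENNReal.ofReal lam else 0) ∂I.streamLaw ≤
      ∫⁻ ω, (ENNReal.ofReal c_rew * (if EverGenerated A u ω i then 1 else 0) +
        ENNReal.ofReal c_ver * (if EverVerified A u ω i then 1 else 0)) ∂I.streamLaw := by
  have hm := I.measurable_h
  have mg : Measurable fun ω : ℕ → ℝ × Bool =>
      if EverGenerated A u ω i then (1 : ℝ≥0∞) else 0 :=
    Measurable.ite (measurable_prodMk_left (measurableSet_everGenerated hA i))
      measurable_const measurable_const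
  have mv : Measurable fun ω : ℕ → ℝ × Bool =>
      if EverVerified A u ω i then (1 : ℝ≥0∞) else 0 :=
    Measurable.ite (measurable_prodMk_left (measurableSet_everVerified hA i))
      measurable_const measurable_const
  have mw : Measurable fun r => ENNReal.ofReal (lam * I.h r - c_ver) := by fun_prop
  rw [I.lintegral_mul_label i mv (fun ω v => by simp only [everVerified_update])
    (fun v => if v = true then ENNReal.ofReal lam else 0)]
  calc _ ≤ ∫⁻ ω, ((if EverGenerated A u ω i then 1 else 0) *
          ENNReal.ofReal (lam * I.h (ω i).1 - c_ver) +
        ENNReal.ofReal c_ver * (if EverVerified A u ω i then 1 else 0)) ∂I.streamLaw := by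
        refine lintegral_mono fun ω => ?_
        by_cases hv : EverVerified A u ω i
        · have hle : ENNReal.ofReal (I.h (ω i).1) * ENNReal.ofReal lam ≤
              ENNReal.ofReal (lam * I.h (ω i).1 - c_ver) + ENNReal.ofReal c_ver := by
            rw [mul_comm, ← ENNReal.ofReal_mul hlam]
            refine (ENNReal.ofReal_le_ofReal ?_).trans ENNReal.ofReal_add_le
            linarith
          simpa [hv, hv.everGenerated hA u] using hle
        · simp [hv]
    _ = (∫⁻ ω, (if EverGenerated A u ω i then 1 else 0) ∂I.streamLaw) *
          (∫⁻ r, ENNReal.ofReal (lam * I.h r - c_ver) ∂I.D) +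
        ∫⁻ ω, ENNReal.ofReal c_ver * (if EverVerified A u ω i then 1 else 0)
          ∂I.streamLaw := by
        rw [lintegral_add_right _ (mv.const_mul _), ← I.lintegral_pairLaw_fst mw,
          ← lintegral_mul_coord I.pairLaw i mg
            (fun ω x => by simp only [everGenerated_update hA])
            (g := fun z => ENNReal.ofReal (lam * I.h z.1 - c_ver)) (by fun_prop)]
    _ ≤ (∫⁻ ω, (if EverGenerated A u ω i then 1 else 0) ∂I.streamLaw) *
          ENNReal.ofReal c_rew +
        ∫⁻ ω, ENNReal.ofReal c_ver * (if EverVerified A u ω i then 1 else 0)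
          ∂I.streamLaw := by gcongr
    _ = _ := by
        rw [lintegral_add_left (mg.const_mul _), lintegral_const_mul _ mg, mul_comm]

include hA in
lemma le_lintegral_candidateCost (I : SearchInstance) {lam : ℝ} (hlam : 0 ≤ lam)
    (hw : ∫⁻ r, ENNReal.ofReal (lam * I.h r - c_ver) ∂I.D ≤ ENNReal.ofReal c_rew) :
    ENNReal.ofReal lam ≤ ∫⁻ ω, candidateCost c_rew c_ver A u ω ∂I.streamLaw := by
  classical
  have mg : ∀ i, Measurable fun ω : ℕ → ℝ × Bool =>
      if EverGenerated A u ω i then (1 : ℝ≥0∞) else 0 := fun i =>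
    Measurable.ite (measurable_prodMk_left (measurableSet_everGenerated hA i))
      measurable_const measurable_const
  have mv : ∀ i, Measurable fun ω : ℕ → ℝ × Bool =>
      if EverVerified A u ω i then (1 : ℝ≥0∞) else 0 := fun i =>
    Measurable.ite (measurable_prodMk_left (measurableSet_everVerified hA i))
      measurable_const measurable_const
  have ms : Measurable fun ω : ℕ → ℝ × Bool => if A.Stops u ω then (0 : ℝ≥0∞) else ⊤ :=
    Measurable.ite (measurable_prodMk_left (measurableSet_stops hA))
      measurable_const measurable_const
  have ml : ∀ i, Measurable fun ω : ℕ → ℝ × Bool =>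
      if (ω i).2 = true then ENNReal.ofReal lam else 0 := fun i =>
    Measurable.ite ((measurable_snd.comp (measurable_pi_apply i)) (measurableSet_singleton true))
      measurable_const measurable_const
  have mc : ∀ i, Measurable fun ω : ℕ → ℝ × Bool =>
      ENNReal.ofReal c_rew * (if EverGenerated A u ω i then 1 else 0) +
        ENNReal.ofReal c_ver * (if EverVerified A u ω i then 1 else 0) := fun i =>
    ((mg i).const_mul _).add ((mv i).const_mul _)
  have mr : ∀ i, Measurable fun ω : ℕ → ℝ × Bool => (if EverVerified A u ω i then 1 else 0) *
      (if (ω i).2 = true then ENNReal.ofReal lam else 0) := fun i => (mv i).mul (ml i)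
  unfold candidateCost
  rw [lintegral_add_right _ ms, lintegral_tsum fun i => (mc i).aemeasurable]
  calc ENNReal.ofReal lam = ∫⁻ _, ENNReal.ofReal lam ∂I.streamLaw := by simp
    _ ≤ ∫⁻ ω, ((∑' i, (if EverVerified A u ω i then 1 else 0) *
          (if (ω i).2 = true then ENNReal.ofReal lam else 0)) +
          if A.Stops u ω then 0 else ⊤) ∂I.streamLaw := by
        refine lintegral_mono fun ω => ?_
        by_cases hs : A.Stops u ω
        · obtain ⟨n, hn⟩ := (stops_iff A u ω).1 hs
          obtain ⟨i, hi⟩ := Option.ne_none_iff_exists'.1 hn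
          have hmem := mem_of_accepted hi
          have hv : EverVerified A u ω i := ⟨n, mem_verified_iff.2 ⟨_, hmem⟩⟩
          have hl := (label_of_mem_history A u ω hmem).symm
          refine le_trans ?_ (le_add_right (ENNReal.le_tsum i))
          simp [hv, hl]
        · simp [hs]
    _ = (∑' i, ∫⁻ ω, (if EverVerified A u ω i then 1 else 0) *
          (if (ω i).2 = true then ENNReal.ofReal lam else 0) ∂I.streamLaw) +
          ∫⁻ ω, (if A.Stops u ω then 0 else ⊤) ∂I.streamLaw := by
        rw [lintegral_add_right _ ms, lintegral_tsum fun i => (mr i).aemeasurable]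
    _ ≤ _ := by
        gcongr ?_ + _
        exact ENNReal.tsum_le_tsum fun i => lintegral_reward_le hA u I hlam hw i

/-- If a positive label is worth `lam` and generating candidates cannot be profitable, then every
sound policy costs at least `lam`. -/
theorem le_Jstar (I : SearchInstance) {lam : ℝ} (hlam : 0 ≤ lam) (hrew : 0 ≤ c_rew)
    (hver : 0 ≤ c_ver)
    (hw : ∫⁻ r, ENNReal.ofReal (lam * I.h r - c_ver) ∂I.D ≤ ENNReal.ofReal c_rew) :
    ENNReal.ofReal lam ≤ Jstar c_rew c_ver I := by
  refine le_iInf₂ fun A hA => ?_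
  calc ENNReal.ofReal lam = ∫⁻ _, ENNReal.ofReal lam ∂A.seedLaw := by simp
    _ ≤ ∫⁻ u, ∫⁻ ω, candidateCost c_rew c_ver A u ω ∂I.streamLaw ∂A.seedLaw :=
        lintegral_mono fun u => le_lintegral_candidateCost hA u I hlam hw
    _ = ∫⁻ z, candidateCost c_rew c_ver A z.1 z.2 ∂(A.seedLaw.prod I.streamLaw) :=
        (lintegral_prod (fun z : A.Seed × (ℕ → ℝ × Bool) =>
          candidateCost c_rew c_ver A z.1 z.2) (measurable_candidateCost hA).aemeasurable).symm
    _ ≤ _ := lintegral_mono fun z => candidateCost_le_cost hrew hver A z.1 z.2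

end LowerBound

/-! ### Shells -/

section Shells

variable {c_rew c_ver : ℝ}

lemma add_mem_shell {s a b : ℕ} (h : (a, b) ∈ shell c_rew c_ver s) (t : ℕ) :
    (a, b + t) ∈ shell c_rew c_ver (s + t) := by
  obtain ⟨h1, h2, h3⟩ := h
  simp only at h1 h2 h3
  have e : c_rew * 2 ^ (b + t) + c_ver * 2 ^ (b + t - a) =
      2 ^ t * (c_rew * 2 ^ b + c_ver * 2 ^ (b - a)) := by
    rw [show b + t - a = (b - a) + t by omega]
    ring
  refine ⟨by simp only; omega, ?_, ?_⟩
  · simp only [e]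
    calc 2 ^ (s + t) * min c_rew c_ver = 2 ^ t * (2 ^ s * min c_rew c_ver) := by ring
      _ ≤ _ := by gcongr
  · simp only [e]
    calc 2 ^ t * (c_rew * 2 ^ b + c_ver * 2 ^ (b - a))
        < 2 ^ t * (2 ^ (s + 1) * min c_rew c_ver) := by gcongr
      _ = _ := by ring

lemma exists_mem_shell (hrew : 0 < c_rew) (hver : 0 < c_ver) {a b : ℕ} (hab : a ≤ b) :
    ∃ s, (a, b) ∈ shell c_rew c_ver s := by
  have hmin : 0 < min c_rew c_ver := lt_min hrew hver
  have h1 : 1 ≤ (c_rew * 2 ^ b + c_ver * 2 ^ (b - a)) / min c_rew c_ver := by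
    rw [one_le_div hmin]
    have : (1 : ℝ) ≤ 2 ^ b := one_le_pow₀ one_le_two
    calc min c_rew c_ver ≤ c_rew * 1 := by simp
      _ ≤ c_rew * 2 ^ b := by gcongr
      _ ≤ _ := le_add_of_nonneg_right (by positivity)
  obtain ⟨s, hs1, hs2⟩ := exists_nat_pow_near h1 one_lt_two
  exact ⟨s, hab, (le_div_iff₀ hmin).1 hs1, (div_lt_iff₀ hmin).1 hs2⟩

lemma exists_shell_nonempty (hrew : 0 < c_rew) (hver : 0 < c_ver) (s : ℕ) :
    ∃ t, s ≤ t ∧ (shell c_rew c_ver t).Nonempty := by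
  obtain ⟨s₀, h⟩ := exists_mem_shell hrew hver (le_refl 0)
  exact ⟨s₀ + s, by omega, _, add_mem_shell h s⟩

lemma nextShell_spec (hrew : 0 < c_rew) (hver : 0 < c_ver) (s : ℕ) :
    s ≤ nextShell c_rew c_ver s ∧ (shell c_rew c_ver (nextShell c_rew c_ver s)).Nonempty :=
  Nat.sInf_mem (exists_shell_nonempty hrew hver s)

lemma nextShell_le {s t : ℕ} (hst : s ≤ t) (ht : (shell c_rew c_ver t).Nonempty) :
    nextShell c_rew c_ver s ≤ t := Nat.sInf_le ⟨hst, ht⟩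

lemma scales_lt_of_mem_shell (hrew : 0 < c_rew) (hver : 0 < c_ver) {s : ℕ} {p : ℕ × ℕ}
    (h : p ∈ shell c_rew c_ver s) : p.2 < s + 1 ∧ p.2 - p.1 < s + 1 := by
  obtain ⟨-, -, h3⟩ := h
  constructor
  · have : c_rew * 2 ^ p.2 < c_rew * 2 ^ (s + 1) := by
      calc c_rew * 2 ^ p.2 ≤ c_rew * 2 ^ p.2 + c_ver * 2 ^ (p.2 - p.1) :=
            le_add_of_nonneg_right (by positivity)
        _ < 2 ^ (s + 1) * min c_rew c_ver := h3
        _ ≤ 2 ^ (s + 1) * c_rew := by gcongr; exact min_le_left _ _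
        _ = _ := mul_comm _ _
    exact (pow_lt_pow_iff_right₀ one_lt_two).1 (lt_of_mul_lt_mul_left this hrew.le)
  · have : c_ver * 2 ^ (p.2 - p.1) < c_ver * 2 ^ (s + 1) := by
      calc c_ver * 2 ^ (p.2 - p.1) ≤ c_rew * 2 ^ p.2 + c_ver * 2 ^ (p.2 - p.1) :=
            le_add_of_nonneg_left (by positivity)
        _ < 2 ^ (s + 1) * min c_rew c_ver := h3
        _ ≤ 2 ^ (s + 1) * c_ver := by gcongr; exact min_le_right _ _
        _ = _ := mul_comm _ _
    exact (pow_lt_pow_iff_right₀ one_lt_two).1 (lt_of_mul_lt_mul_left this hver.le)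

lemma bddAbove_gen_scales (hrew : 0 < c_rew) (hver : 0 < c_ver) (s : ℕ) :
    BddAbove ((fun p : ℕ × ℕ => p.2) '' shell c_rew c_ver s) := by
  refine ⟨s + 1, ?_⟩
  rintro _ ⟨p, hp, rfl⟩
  exact (scales_lt_of_mem_shell hrew hver hp).1.le

lemma bddAbove_ver_scales (hrew : 0 < c_rew) (hver : 0 < c_ver) (s : ℕ) :
    BddAbove ((fun p : ℕ × ℕ => p.2 - p.1) '' shell c_rew c_ver s) := by
  refine ⟨s + 1, ?_⟩
  rintro _ ⟨p, hp, rfl⟩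
  exact (scales_lt_of_mem_shell hrew hver hp).2.le

lemma le_genBudget (hrew : 0 < c_rew) (hver : 0 < c_ver) {s a b : ℕ}
    (h : (a, b) ∈ shell c_rew c_ver s) : 2 ^ (b + 1) ≤ genBudget c_rew c_ver s :=
  Nat.pow_le_pow_right two_pos
    (Nat.succ_le_succ (le_csSup (bddAbove_gen_scales hrew hver s) ⟨(a, b), h, rfl⟩))

lemma le_verBudget (hrew : 0 < c_rew) (hver : 0 < c_ver) {s a b : ℕ}
    (h : (a, b) ∈ shell c_rew c_ver s) : 6 * 2 ^ (b - a) ≤ verBudget c_rew c_ver s :=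
  Nat.mul_le_mul_left _ (Nat.pow_le_pow_right two_pos
    (le_csSup (bddAbove_ver_scales hrew hver s) ⟨(a, b), h, rfl⟩))

lemma genBudget_pos (s : ℕ) : 0 < genBudget c_rew c_ver s := by
  unfold genBudget
  positivity

lemma verBudget_pos (s : ℕ) : 0 < verBudget c_rew c_ver s := by
  unfold verBudget
  positivity

/-- The price of all actions in a shell is at most `16 * 2 ^ s * min c_rew c_ver`. -/
lemma shell_price_le (hrew : 0 < c_rew) (hver : 0 < c_ver) {s : ℕ}
    (hs : (shell c_rew c_ver s).Nonempty) :
    c_rew * genBudget c_rew c_ver s + c_ver * verBudget c_rew c_ver s ≤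
      16 * (2 ^ s * min c_rew c_ver) := by
  obtain ⟨p, hp, hpb⟩ := Nat.sSup_mem (hs.image fun p : ℕ × ℕ => p.2)
    (bddAbove_gen_scales hrew hver s)
  obtain ⟨q, hq, hqb⟩ := Nat.sSup_mem (hs.image fun p : ℕ × ℕ => p.2 - p.1)
    (bddAbove_ver_scales hrew hver s)
  have h1 : c_rew * 2 ^ p.2 ≤ 2 ^ (s + 1) * min c_rew c_ver :=
    (le_add_of_nonneg_right (by positivity)).trans hp.2.2.le
  have h2 : c_ver * 2 ^ (q.2 - q.1) ≤ 2 ^ (s + 1) * min c_rew c_ver :=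
    (le_add_of_nonneg_left (by positivity)).trans hq.2.2.le
  unfold genBudget verBudget
  rw [← hpb, ← hqb]
  push_cast
  rw [pow_succ] at h1 h2 ⊢
  linarith

open Classical in
/-- The number of candidates generated before shell `s`. -/
noncomputable def genBefore (c_rew c_ver : ℝ) (s : ℕ) : ℕ :=
  ∑ t ∈ Finset.range s, if (shell c_rew c_ver t).Nonempty then genBudget c_rew c_ver t else 0

open Classical in
/-- The largest possible price of the actions in shell `s`. -/
noncomputable def shellPrice (c_rew c_ver : ℝ) (s : ℕ) : ℝ≥0∞ :=
  if (shell c_rew c_ver s).Nonempty then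
    ENNReal.ofReal c_rew * genBudget c_rew c_ver s + ENNReal.ofReal c_ver * verBudget c_rew c_ver s
  else 0

lemma genBefore_succ {s : ℕ} (hs : (shell c_rew c_ver s).Nonempty) :
    genBefore c_rew c_ver (s + 1) = genBefore c_rew c_ver s + genBudget c_rew c_ver s := by
  rw [genBefore, Finset.sum_range_succ, if_pos hs, genBefore]

lemma genBefore_nextShell (hrew : 0 < c_rew) (hver : 0 < c_ver) (s : ℕ) :
    genBefore c_rew c_ver (nextShell c_rew c_ver s) = genBefore c_rew c_ver s := by
  classical
  unfold genBefore
  symm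
  refine Finset.sum_subset
    (Finset.range_subset_range.2 (nextShell_spec hrew hver s).1) fun t ht hts => ?_
  rw [if_neg]
  intro hne
  have := nextShell_le (by simpa using hts) hne
  simp at ht
  omega

lemma shellPrice_le (hrew : 0 < c_rew) (hver : 0 < c_ver) (s : ℕ) :
    shellPrice c_rew c_ver s ≤ ENNReal.ofReal (16 * (2 ^ s * min c_rew c_ver)) := by
  unfold shellPrice
  split_ifs with hs
  · rw [← ENNReal.ofReal_natCast, ← ENNReal.ofReal_natCast, ← ENNReal.ofReal_mul hrew.le,
      ← ENNReal.ofReal_mul hver.le, ← ENNReal.ofReal_add (by positivity) (by positivity)]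
    exact ENNReal.ofReal_le_ofReal (shell_price_le hrew hver hs)
  · exact zero_le

end Shells

/-! ### Invariants of the shellwise policy -/

section Invariants

variable {c_rew c_ver : ℝ} {rank : List (ℕ × ℝ) → List (ℕ × ℝ)}

lemma AdapState.onLabel_of_queue_eq_singleton {σ : AdapState} {i : ℕ} (h : σ.queue = [i]) :
    σ.onLabel c_rew c_ver i = AdapState.enter c_rew c_ver (σ.s + 1) σ.count
      (σ.pool.filter fun p => p.1 ≠ i) := by
  simp only [AdapState.onLabel, h]

lemma AdapState.onLabel_of_queue_eq_cons {σ : AdapState} {i j : ℕ} {q : List ℕ}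
    (h : σ.queue = i :: j :: q) :
    σ.onLabel c_rew c_ver i =
      { σ with queue := j :: q, pool := σ.pool.filter fun p => p.1 ≠ i } := by
  simp only [AdapState.onLabel, h]

/-- Consistency of a state with a history on scores `R`. -/
structure AdapState.Consistent (R : ℕ → ℝ) (H : List Event) (σ : AdapState) : Prop where
  count_eq : σ.count = numRew H
  score : ∀ p ∈ σ.pool, p.2 = R p.1
  lt_count : ∀ p ∈ σ.pool, p.1 < σ.count
  nodup_pool : (σ.pool.map Prod.fst).Nodup
  unverified : ∀ p ∈ σ.pool, p.1 ∉ verified H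
  nodup_queue : σ.queue.Nodup
  queue_subset : ∀ i ∈ σ.queue, (i, R i) ∈ σ.pool
  verified_lt : ∀ i ∈ verified H, i < σ.count
  nodup_verified : (verified H).Nodup
  toGen_pos : σ.queue = [] → 0 < σ.toGen

lemma AdapState.consistent_nil (R : ℕ → ℝ) :
    (adapState c_rew c_ver rank []).Consistent R [] := by
  constructor <;> simp [adapState, AdapState.enter, numRew, verified, shapes, genBudget_pos]

lemma nodup_map_fst_filter {P : List (ℕ × ℝ)} (h : (P.map Prod.fst).Nodup) (f : ℕ × ℝ → Bool) :
    ((P.filter f).map Prod.fst).Nodup :=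
  h.sublist (List.filter_sublist.map _)

lemma nodup_map_fst_rank_take (hrank : IsRanking rank) {P : List (ℕ × ℝ)}
    (h : (P.map Prod.fst).Nodup) (k : ℕ) : (((rank P).take k).map Prod.fst).Nodup :=
  (((hrank.perm P).map Prod.fst).nodup_iff.2 h).sublist ((List.take_sublist _ _).map _)

lemma AdapState.Consistent.onScore (hrank : IsRanking rank) {R : ℕ → ℝ} {H : List Event}
    {σ : AdapState} (h : σ.Consistent R H) :
    (σ.onScore c_rew c_ver rank (R (numRew H))).Consistent R
      (Sum.inl (R (numRew H)) :: H) := by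
  have hlt : ∀ p ∈ (σ.count, R (numRew H)) :: σ.pool, p.1 < σ.count + 1 := by
    intro p hp
    rcases List.mem_cons.1 hp with rfl | hp
    · simp
    · exact (h.lt_count p hp).trans (Nat.lt_succ_self _)
  have hscore : ∀ p ∈ (σ.count, R (numRew H)) :: σ.pool, p.2 = R p.1 := by
    intro p hp
    rcases List.mem_cons.1 hp with rfl | hp
    · rw [h.count_eq]
    · exact h.score p hp
  have hnodup : (((σ.count, R (numRew H)) :: σ.pool).map Prod.fst).Nodup := by
    rw [List.map_cons, List.nodup_cons]
    refine ⟨fun hmem => ?_, h.nodup_pool⟩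
    obtain ⟨p, hp, hpc⟩ := List.mem_map.1 hmem
    exact (h.lt_count p hp).ne hpc
  refine ⟨?_, hscore, hlt, hnodup, ?_, ?_, ?_, ?_, ?_, ?_⟩
  · simp [AdapState.onScore, h.count_eq]
  · intro p hp
    rcases List.mem_cons.1 hp with rfl | hp
    · exact fun hv => (h.verified_lt _ hv).ne rfl
    · exact h.unverified p hp
  · simp only [AdapState.onScore]
    split_ifs
    · exact nodup_map_fst_rank_take hrank hnodup _
    · exact List.nodup_nil
  · simp only [AdapState.onScore]
    split_ifs
    · intro i hi
      obtain ⟨p, hp, rfl⟩ := List.mem_map.1 hi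
      have hp' := (hrank.perm _).mem_iff.1 (List.mem_of_mem_take hp)
      rwa [← hscore p hp']
    · simp
  · exact fun i hi => (h.verified_lt i hi).trans (Nat.lt_succ_self _)
  · exact h.nodup_verified
  · simp only [AdapState.onScore]
    split_ifs with hg
    · intro hnil
      rw [List.map_eq_nil_iff, List.take_eq_nil_iff] at hnil
      rcases hnil with hk | hr
      · exact absurd hk (verBudget_pos _).ne'
      · have := (hrank.perm ((σ.count, R (numRew H)) :: σ.pool)).length_eq
        simp [hr] at this
    · intro
      omega

lemma AdapState.Consistent.onLabel {R : ℕ → ℝ} {H : List Event} {σ : AdapState}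
    (h : σ.Consistent R H) {i : ℕ} {q : List ℕ} (hq : σ.queue = i :: q) (v : Bool) :
    (σ.onLabel c_rew c_ver i).Consistent R (Sum.inr (i, v) :: H) := by
  have hi : (i, R i) ∈ σ.pool := h.queue_subset i (by simp [hq])
  have hic : i < σ.count := h.lt_count _ hi
  have hvl : ∀ j ∈ verified (Sum.inr (i, v) :: H), j < σ.count := by
    intro j hj
    rcases List.mem_cons.1 hj with rfl | hj
    · exact hic
    · exact h.verified_lt j hj
  have hvn : (verified (Sum.inr (i, v) :: H)).Nodup := by
    rw [verified_cons_inr, List.nodup_cons]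
    exact ⟨h.unverified _ hi, h.nodup_verified⟩
  have hunv : ∀ p ∈ σ.pool.filter (fun p => p.1 ≠ i), p.1 ∉ verified (Sum.inr (i, v) :: H) := by
    intro p hp
    rw [List.mem_filter] at hp
    have h1 := h.unverified p hp.1
    have h2 := hp.2
    simp only [ne_eq, decide_not, Bool.not_eq_eq_eq_not, Bool.not_true,
      decide_eq_false_iff_not] at h2
    simp [h1, h2]
  have hsub : ∀ p ∈ σ.pool.filter (fun p => p.1 ≠ i), p ∈ σ.pool := fun p hp =>
    List.mem_of_mem_filter hp
  rcases q with _ | ⟨j, q⟩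
  · rw [AdapState.onLabel_of_queue_eq_singleton hq]
    exact ⟨by simp [AdapState.enter, h.count_eq], fun p hp => h.score p (hsub p hp),
      fun p hp => h.lt_count p (hsub p hp), nodup_map_fst_filter h.nodup_pool _, hunv,
      List.nodup_nil, fun _ h => by simp [AdapState.enter] at h, hvl, hvn,
      fun _ => genBudget_pos _⟩
  · rw [AdapState.onLabel_of_queue_eq_cons hq]
    have hnq := h.nodup_queue
    rw [hq, List.nodup_cons] at hnq
    refine ⟨by simp [h.count_eq], fun p hp => h.score p (hsub p hp),
      fun p hp => h.lt_count p (hsub p hp), nodup_map_fst_filter h.nodup_pool _, hunv,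
      hnq.2, fun k hk => ?_, hvl, hvn, fun h => by simp at h⟩
    refine List.mem_filter.2 ⟨h.queue_subset k (by simp [hq, hk]), ?_⟩
    have : k ≠ i := fun e => hnq.1 (e ▸ hk)
    simpa using this

/-- The run of the shellwise policy on scores `R` and negative labels. -/
noncomputable def adapRun (c_rew c_ver : ℝ) (rank : List (ℕ × ℝ) → List (ℕ × ℝ)) (R : ℕ → ℝ)
    (n : ℕ) : List Event :=
  (adap c_rew c_ver rank).history () (negStream R) n

lemma adapRun_succ (R : ℕ → ℝ) (n : ℕ) :
    ((adapState c_rew c_ver rank (adapRun c_rew c_ver rank R n)).queue = [] ∧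
      (adap c_rew c_ver rank).act () (adapRun c_rew c_ver rank R n) = .generate ∧
      adapRun c_rew c_ver rank R (n + 1) =
        Sum.inl (R (numRew (adapRun c_rew c_ver rank R n))) :: adapRun c_rew c_ver rank R n) ∨
    (∃ i q, (adapState c_rew c_ver rank (adapRun c_rew c_ver rank R n)).queue = i :: q ∧
      (adap c_rew c_ver rank).act () (adapRun c_rew c_ver rank R n) = .verify i ∧
      adapRun c_rew c_ver rank R (n + 1) =
        Sum.inr (i, false) :: adapRun c_rew c_ver rank R n) := by
  have hacc := accepted_history_negStream (adap c_rew c_ver rank) () R n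
  rcases hq : (adapState c_rew c_ver rank (adapRun c_rew c_ver rank R n)).queue with _ | ⟨i, q⟩
  · have ha : (adap c_rew c_ver rank).act () (adapRun c_rew c_ver rank R n) = .generate := by
      simp only [adap, AdapState.next, hq]
    exact .inl ⟨rfl, ha, history_succ_generate (adap c_rew c_ver rank) () (negStream R) hacc ha⟩
  · have ha : (adap c_rew c_ver rank).act () (adapRun c_rew c_ver rank R n) = .verify i := by
      simp only [adap, AdapState.next, hq]
    exact .inr ⟨i, q, rfl, ha, history_succ_verify (adap c_rew c_ver rank) () (negStream R) hacc ha⟩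

lemma consistent_adapRun (hrank : IsRanking rank) (R : ℕ → ℝ) (n : ℕ) :
    (adapState c_rew c_ver rank (adapRun c_rew c_ver rank R n)).Consistent R
      (adapRun c_rew c_ver rank R n) := by
  induction n with
  | zero => exact AdapState.consistent_nil R
  | succ n ih =>
    rcases adapRun_succ (c_rew := c_rew) (c_ver := c_ver) (rank := rank) R n with
      ⟨-, -, h⟩ | ⟨i, q, hq, -, h⟩
    · rw [h]
      exact ih.onScore hrank
    · rw [h]
      exact ih.onLabel hq false

lemma adap_verify_mem_pool (hrank : IsRanking rank) (u : (adap c_rew c_ver rank).Seed)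
    (ω : ℕ → ℝ × Bool) (n i : ℕ)
    (hacc : accepted ((adap c_rew c_ver rank).history u ω n) = none)
    (ha : (adap c_rew c_ver rank).act u ((adap c_rew c_ver rank).history u ω n) = .verify i) :
    InPool ((adap c_rew c_ver rank).history u ω n) i := by
  have h2 : (adap c_rew c_ver rank).history u ω n =
      adapRun c_rew c_ver rank (fun j => (ω j).1) n := by
    rcases history_eq_negStream (adap c_rew c_ver rank) u ω n with h | h
    · exact h.2
    · exact absurd hacc h.2
  rw [h2] at ha ⊢
  have hc := consistent_adapRun (c_rew := c_rew) (c_ver := c_ver) hrank (fun j => (ω j).1) n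
  rcases adapRun_succ (c_rew := c_rew) (c_ver := c_ver) (rank := rank)
      (fun j => (ω j).1) n with ⟨-, ha', -⟩ | ⟨k, q, hq, ha', -⟩
  · cases ha.symm.trans ha'
  · cases ha.symm.trans ha'
    have hmem := hc.queue_subset i (by simp [hq])
    exact ⟨hc.count_eq ▸ hc.lt_count _ hmem,
      fun v hv => hc.unverified _ hmem (mem_verified_iff.2 ⟨v, hv⟩)⟩

end Invariants

/-! ### The cost of the shellwise policy on given scores -/

section Phases

variable {c_rew c_ver : ℝ} {rank : List (ℕ × ℝ) → List (ℕ × ℝ)}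

/-- `P` is a list of scored candidates which contains all candidates that are generated in
shell `s`. -/
structure IsPoolOf (c_rew c_ver : ℝ) (R : ℕ → ℝ) (s : ℕ) (P : List (ℕ × ℝ)) : Prop where
  score : ∀ p ∈ P, p.2 = R p.1
  nodup : (P.map Prod.fst).Nodup
  fresh : ∀ i, genBefore c_rew c_ver s ≤ i → i < genBefore c_rew c_ver (s + 1) → (i, R i) ∈ P

/-- The product of `g (R i)` over the candidates verified in a history. -/
noncomputable def verifiedProd (g : ℝ → ℝ≥0∞) (R : ℕ → ℝ) (H : List Event) : ℝ≥0∞ :=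
  ((verified H).map fun i => g (R i)).prod

/-- The factor `Y s` bounds the product of `g` over the candidates verified before shell `s`. In
`step` the list is the queue of shell `s`; the minimum with `1` makes the condition void for those
shells whose failure is not taken into account. -/
structure IsDecay (c_rew c_ver : ℝ) (rank : List (ℕ × ℝ) → List (ℕ × ℝ)) (g : ℝ → ℝ≥0∞)
    (R : ℕ → ℝ) (Y : ℕ → ℝ≥0∞) : Prop where
  le_one : ∀ r, g r ≤ 1
  start : 1 ≤ Y (nextShell c_rew c_ver 0)
  step : ∀ s P, (shell c_rew c_ver s).Nonempty → IsPoolOf c_rew c_ver R s P →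
    min 1 (Y s * ((((rank P).take (verBudget c_rew c_ver s)).map Prod.fst).map
      fun i => g (R i)).prod) ≤ Y (nextShell c_rew c_ver (s + 1))

/-- The total price of the shells before `s`, where shell `t` is weighted by `Y t`. -/
noncomputable def priceBefore (c_rew c_ver : ℝ) (Y : ℕ → ℝ≥0∞) (s : ℕ) : ℝ≥0∞ :=
  ∑ t ∈ Finset.range s, shellPrice c_rew c_ver t * Y t

/-- While candidates are being generated in a shell, the price of the rest of the shell is still
available. -/
structure GenPhase (c_rew c_ver : ℝ) (g : ℝ → ℝ≥0∞) (R : ℕ → ℝ) (Y : ℕ → ℝ≥0∞)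
    (S : ℝ≥0∞) (H : List Event) (σ : AdapState) : Prop where
  queue : σ.queue = []
  nonempty : (shell c_rew c_ver σ.s).Nonempty
  count : σ.count + σ.toGen = genBefore c_rew c_ver (σ.s + 1)
  fresh : ∀ i, genBefore c_rew c_ver σ.s ≤ i → i < σ.count → (i, R i) ∈ σ.pool
  prod : verifiedProd g R H ≤ Y σ.s
  price : S + (ENNReal.ofReal c_rew * σ.toGen +
    ENNReal.ofReal c_ver * verBudget c_rew c_ver σ.s) * Y σ.s ≤
      priceBefore c_rew c_ver Y (σ.s + 1)

/-- While candidates are being verified in a shell, the price of the remaining verifications is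
still available. -/
structure VerPhase (c_rew c_ver : ℝ) (rank : List (ℕ × ℝ) → List (ℕ × ℝ)) (g : ℝ → ℝ≥0∞)
    (R : ℕ → ℝ) (Y : ℕ → ℝ≥0∞) (S : ℝ≥0∞) (H : List Event) (σ : AdapState) : Prop where
  queue : σ.queue ≠ []
  nonempty : (shell c_rew c_ver σ.s).Nonempty
  count : σ.count = genBefore c_rew c_ver (σ.s + 1)
  ranked : ∃ done P, IsPoolOf c_rew c_ver R σ.s P ∧
    done ++ σ.queue = ((rank P).take (verBudget c_rew c_ver σ.s)).map Prod.fst ∧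
    verifiedProd g R H ≤ Y σ.s * (done.map fun i => g (R i)).prod
  price : S + (ENNReal.ofReal c_ver * σ.queue.length) * Y σ.s ≤
    priceBefore c_rew c_ver Y (σ.s + 1)

variable {g : ℝ → ℝ≥0∞} {R : ℕ → ℝ} {Y : ℕ → ℝ≥0∞} {S : ℝ≥0∞} {H : List Event} {σ : AdapState}

lemma prod_map_le_one (hg : ∀ r, g r ≤ 1) (l : List ℕ) : (l.map fun i => g (R i)).prod ≤ 1 := by
  induction l with
  | nil => simp
  | cons i l ih =>
    rw [List.map_cons, List.prod_cons]
    exact mul_le_one' (hg _) ih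

/-- Empty shells are skipped; they contribute neither candidates nor costs. -/
lemma genPhase_enter (hrew : 0 < c_rew) (hver : 0 < c_ver) {s count : ℕ}
    (hcount : count = genBefore c_rew c_ver s) (pool : List (ℕ × ℝ))
    (hprod : verifiedProd g R H ≤ Y (nextShell c_rew c_ver s))
    (hS : S ≤ priceBefore c_rew c_ver Y s) :
    GenPhase c_rew c_ver g R Y S H (AdapState.enter c_rew c_ver s count pool) := by
  have hne := (nextShell_spec hrew hver s).2
  refine ⟨rfl, hne, ?_, ?_, hprod, ?_⟩
  · simp only [AdapState.enter]
    rw [genBefore_succ hne, genBefore_nextShell hrew hver, hcount]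
  · intro i h1 h2
    simp only [AdapState.enter] at h1 h2
    rw [genBefore_nextShell hrew hver] at h1
    omega
  · simp only [AdapState.enter]
    rw [priceBefore, Finset.sum_range_succ, shellPrice, if_pos hne]
    gcongr
    exact hS.trans (Finset.sum_le_sum_of_subset
      (Finset.range_subset_range.2 (nextShell_spec hrew hver s).1))

lemma GenPhase.onScore (hrank : IsRanking rank)
    (h : GenPhase c_rew c_ver g R Y S H σ) (hc : σ.Consistent R H) :
    GenPhase c_rew c_ver g R Y (S + ENNReal.ofReal c_rew * verifiedProd g R H)
      (Sum.inl (R (numRew H)) :: H) (σ.onScore c_rew c_ver rank (R (numRew H))) ∨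
    VerPhase c_rew c_ver rank g R Y (S + ENNReal.ofReal c_rew * verifiedProd g R H)
      (Sum.inl (R (numRew H)) :: H) (σ.onScore c_rew c_ver rank (R (numRew H))) := by
  have hpos := hc.toGen_pos h.queue
  have hc' := hc.onScore (c_rew := c_rew) (c_ver := c_ver) hrank
  have hfresh : ∀ i, genBefore c_rew c_ver σ.s ≤ i → i < σ.count + 1 →
      (i, R i) ∈ (σ.count, R (numRew H)) :: σ.pool := by
    intro i h1 h2
    rcases (Nat.lt_succ_iff_lt_or_eq.1 h2) with h2 | rfl
    · exact List.mem_cons_of_mem _ (h.fresh i h1 h2)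
    · rw [hc.count_eq]
      exact List.mem_cons_self
  have hprice : S + ENNReal.ofReal c_rew * verifiedProd g R H +
      (ENNReal.ofReal c_rew * (σ.toGen - 1 : ℕ) +
        ENNReal.ofReal c_ver * verBudget c_rew c_ver σ.s) * Y σ.s ≤
      priceBefore c_rew c_ver Y (σ.s + 1) := by
    refine le_trans ?_ h.price
    have e : ((σ.toGen : ℕ) : ℝ≥0∞) = 1 + (σ.toGen - 1 : ℕ) := by
      norm_cast
      omega
    rw [e, add_assoc, mul_add, mul_one, add_assoc, add_mul (ENNReal.ofReal c_rew)]
    gcongr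
    exact h.prod
  by_cases hg : σ.toGen ≤ 1
  · right
    have hcount : σ.count + 1 = genBefore c_rew c_ver (σ.s + 1) := by
      have := h.count
      omega
    have hqueue : (σ.onScore c_rew c_ver rank (R (numRew H))).queue =
        ((rank ((σ.count, R (numRew H)) :: σ.pool)).take
          (verBudget c_rew c_ver σ.s)).map Prod.fst := by
      simp [AdapState.onScore, hg]
    refine ⟨fun hnil => ?_, h.nonempty, hcount, ⟨[], _, ⟨hc'.score, hc'.nodup_pool, ?_⟩,
      hqueue, ?_⟩, ?_⟩
    · have := hc'.toGen_pos hnil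
      simp only [AdapState.onScore] at this
      omega
    · intro i h1 h2
      exact hfresh i h1 (by rw [hcount]; exact h2)
    · simpa [verifiedProd, AdapState.onScore] using h.prod
    · refine le_trans ?_ hprice
      change _ + _ * Y σ.s ≤ _
      gcongr
      refine le_add_left ?_
      gcongr
      rw [hqueue, List.length_map]
      exact List.length_take_le _ _
  · left
    refine ⟨by simp [AdapState.onScore, hg], h.nonempty, ?_, hfresh, h.prod, hprice⟩
    have := h.count
    simp only [AdapState.onScore]
    omega

lemma VerPhase.onLabel (hrew : 0 < c_rew) (hver : 0 < c_ver)
    (hY : IsDecay c_rew c_ver rank g R Y)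
    (h : VerPhase c_rew c_ver rank g R Y S H σ) {i : ℕ} {q : List ℕ} (hq : σ.queue = i :: q)
    (v : Bool) :
    GenPhase c_rew c_ver g R Y (S + ENNReal.ofReal c_ver * verifiedProd g R H)
      (Sum.inr (i, v) :: H) (σ.onLabel c_rew c_ver i) ∨
    VerPhase c_rew c_ver rank g R Y (S + ENNReal.ofReal c_ver * verifiedProd g R H)
      (Sum.inr (i, v) :: H) (σ.onLabel c_rew c_ver i) := by
  obtain ⟨done, P, hP, hdone, hprod⟩ := h.ranked
  have hYs : verifiedProd g R H ≤ Y σ.s :=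
    hprod.trans (mul_le_of_le_one_right' (prod_map_le_one hY.le_one done))
  have hprod' : verifiedProd g R (Sum.inr (i, v) :: H) ≤
      Y σ.s * ((done ++ [i]).map fun i => g (R i)).prod := by
    simp only [verifiedProd, verified_cons_inr, List.map_cons, List.prod_cons, List.map_append,
      List.prod_append, List.map_nil, List.prod_nil, mul_one]
    rw [← mul_assoc, mul_comm (g (R i))]
    exact mul_le_mul_left hprod _
  have hprice : S + ENNReal.ofReal c_ver * verifiedProd g R H +
      (ENNReal.ofReal c_ver * q.length) * Y σ.s ≤ priceBefore c_rew c_ver Y (σ.s + 1) := by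
    refine le_trans ?_ h.price
    rw [hq, List.length_cons, Nat.cast_succ, add_comm (q.length : ℝ≥0∞) 1, mul_add, mul_one,
      add_mul, add_assoc]
    gcongr
  rcases q with _ | ⟨j, q⟩
  · left
    rw [AdapState.onLabel_of_queue_eq_singleton hq]
    refine genPhase_enter hrew hver h.count _ ?_ (by simpa using hprice)
    refine le_trans (le_min (prod_map_le_one hY.le_one _) ?_) (hY.step σ.s P h.nonempty hP)
    rwa [← hdone, hq]
  · right
    rw [AdapState.onLabel_of_queue_eq_cons hq]
    refine ⟨by simp, h.nonempty, h.count, ⟨done ++ [i], P, hP, ?_, hprod'⟩, hprice⟩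
    rw [← hdone, hq]
    simp

lemma phase_adapRun (hrew : 0 < c_rew) (hver : 0 < c_ver) (hrank : IsRanking rank)
    (hY : IsDecay c_rew c_ver rank g R Y) (n : ℕ) :
    GenPhase c_rew c_ver g R Y
      (∑ k ∈ Finset.range n,
        stepCost c_rew c_ver ((adap c_rew c_ver rank).act () (adapRun c_rew c_ver rank R k)) *
          verifiedProd g R (adapRun c_rew c_ver rank R k))
      (adapRun c_rew c_ver rank R n)
      (adapState c_rew c_ver rank (adapRun c_rew c_ver rank R n)) ∨
    VerPhase c_rew c_ver rank g R Y
      (∑ k ∈ Finset.range n,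
        stepCost c_rew c_ver ((adap c_rew c_ver rank).act () (adapRun c_rew c_ver rank R k)) *
          verifiedProd g R (adapRun c_rew c_ver rank R k))
      (adapRun c_rew c_ver rank R n)
      (adapState c_rew c_ver rank (adapRun c_rew c_ver rank R n)) := by
  induction n with
  | zero =>
    left
    refine genPhase_enter hrew hver (by simp [genBefore]) _ ?_ (by simp)
    simpa [verifiedProd, adapRun, Policy.history, verified, shapes] using hY.start
  | succ n ih =>
    rw [Finset.sum_range_succ]
    have hc := consistent_adapRun (c_rew := c_rew) (c_ver := c_ver) hrank R n
    rcases adapRun_succ (c_rew := c_rew) (c_ver := c_ver) (rank := rank) R n with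
      ⟨hq, ha, h⟩ | ⟨i, q, hq, ha, h⟩
    · rw [h, ha]
      rcases ih with ih | ih
      · exact ih.onScore hrank hc
      · exact absurd hq ih.queue
    · rw [h, ha]
      rcases ih with ih | ih
      · rw [ih.queue] at hq
        cases hq
      · exact ih.onLabel hrew hver hY hq false

/-- When `g` is the probability of a negative label, the left-hand side is the conditional expected
cost of the policy given the scores. It is at most the price of all shells, each weighted by a
bound for the probability that it is reached. -/
lemma tsum_stepCost_mul_verifiedProd_le (hrew : 0 < c_rew) (hver : 0 < c_ver)
    (hrank : IsRanking rank) (hY : IsDecay c_rew c_ver rank g R Y) :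
    ∑' n, stepCost c_rew c_ver
        ((adap c_rew c_ver rank).act () (adapRun c_rew c_ver rank R n)) *
          verifiedProd g R (adapRun c_rew c_ver rank R n) ≤
      ∑' s, shellPrice c_rew c_ver s * Y s := by
  rw [ENNReal.tsum_eq_iSup_nat]
  refine iSup_le fun n => ?_
  have hle : ∀ s, priceBefore c_rew c_ver Y s ≤ ∑' s, shellPrice c_rew c_ver s * Y s :=
    fun s => ENNReal.sum_le_tsum _
  rcases phase_adapRun hrew hver hrank hY n with h | h
  · exact (le_self_add.trans h.price).trans (hle _)
  · exact (le_self_add.trans h.price).trans (hle _)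

end Phases

/-! ### The shellwise policy is sound -/

section Measurability

variable {Z : Type*} [MeasurableSpace Z] {c_rew c_ver : ℝ}
  {rank : List (ℕ × ℝ) → List (ℕ × ℝ)}

/-- The discrete part of a state: everything except the values of the scores. -/
def AdapState.disc (σ : AdapState) : ℕ × ℕ × List ℕ × ℕ × List ℕ :=
  (σ.s, σ.toGen, σ.queue, σ.count, σ.pool.map Prod.fst)

/-- The state with a given discrete part and given scores. -/
def AdapState.ofDisc (d : ℕ × ℕ × List ℕ × ℕ × List ℕ) (sc : ℕ → ℝ) : AdapState where
  s := d.1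
  toGen := d.2.1
  queue := d.2.2.1
  count := d.2.2.2.1
  pool := d.2.2.2.2.map fun k => (k, sc k)

/-- A state that depends measurably on a parameter: its discrete part is measurable, and the
score of every candidate in the pool is given by a measurable function. -/
structure MeasurableState (σ : Z → AdapState) : Prop where
  disc : ∀ d, MeasurableSet {z | (σ z).disc = d}
  score : ∃ sc : Z → ℕ → ℝ, (∀ k, Measurable fun z => sc z k) ∧
    ∀ z, ∀ p ∈ (σ z).pool, p.2 = sc z p.1
  lt_count : ∀ z, ∀ p ∈ (σ z).pool, p.1 < (σ z).count

lemma AdapState.ofDisc_disc {σ : AdapState} {sc : ℕ → ℝ} (h : ∀ p ∈ σ.pool, p.2 = sc p.1) :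
    AdapState.ofDisc σ.disc sc = σ := by
  have : (σ.pool.map Prod.fst).map (fun k => (k, sc k)) = σ.pool := by
    rw [List.map_map]
    conv_rhs => rw [← List.map_id σ.pool]
    exact List.map_congr_left fun p hp => by simp [← h p hp]
  simp [AdapState.ofDisc, AdapState.disc, this]

lemma AdapState.disc_onLabel_congr {σ τ : AdapState} (h : σ.disc = τ.disc) (i : ℕ) :
    (σ.onLabel c_rew c_ver i).disc = (τ.onLabel c_rew c_ver i).disc := by
  have hfilter : ∀ P : List (ℕ × ℝ), (P.filter fun p => p.1 ≠ i).map Prod.fst =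
      (P.map Prod.fst).filter fun k => k ≠ i := fun P => by
    rw [List.filter_map]
    rfl
  obtain ⟨s, g, q, c, P⟩ := σ
  obtain ⟨s', g', q', c', P'⟩ := τ
  simp only [AdapState.disc, Prod.mk.injEq] at h
  obtain ⟨rfl, rfl, rfl, rfl, hP⟩ := h
  match q with
  | [] =>
    simp only [AdapState.onLabel, AdapState.disc, AdapState.enter]
    rw [hfilter P, hfilter P', hP]
  | [_] =>
    simp only [AdapState.onLabel, AdapState.disc, AdapState.enter]
    rw [hfilter P, hfilter P', hP]
  | _ :: _ :: _ =>
    simp only [AdapState.onLabel, AdapState.disc]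
    rw [hfilter P, hfilter P', hP]

lemma AdapState.disc_ofDisc (d : ℕ × ℕ × List ℕ × ℕ × List ℕ) (sc : ℕ → ℝ) :
    (AdapState.ofDisc d sc).disc = d := by
  simp [AdapState.disc, AdapState.ofDisc, Function.comp_def]

/-- The score of a generated candidate, and `0` for a label. -/
def eventScore : Event → ℝ := Sum.elim id fun _ => 0

lemma measurable_eventScore : Measurable eventScore := measurable_id.sumElim measurable_const

lemma measurableSet_getRight? (s : Shape) : MeasurableSet {e : Event | e.getRight? = s} := by
  rcases s with _ | x
  · have : {e : Event | e.getRight? = none} = Set.range Sum.inl := by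
      ext e
      rcases e with r | x <;> simp
    rw [this]
    exact measurableSet_range_inl
  · have : {e : Event | e.getRight? = some x} = Sum.inr '' {x} := by
      ext e
      rcases e with r | y <;> simp [eq_comm]
    rw [this]
    exact (measurableSet_singleton x).inr_image

/-- One step of the algorithm, in terms of the shape and the score of the event. -/
noncomputable def AdapState.step (c_rew c_ver : ℝ) (rank : List (ℕ × ℝ) → List (ℕ × ℝ))
    (σ : AdapState) (s : Shape) (r : ℝ) : AdapState :=
  match s with
  | none => σ.onScore c_rew c_ver rank r
  | some x => σ.onLabel c_rew c_ver x.1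

lemma adapState_cons (e : Event) (H : List Event) :
    adapState c_rew c_ver rank (e :: H) =
      (adapState c_rew c_ver rank H).step c_rew c_ver rank e.getRight? (eventScore e) := by
  rcases e with r | ⟨i, v⟩ <;> rfl

lemma measurableSet_rank_map (hrank : IsRanking rank) (c : ℕ) (idx : List ℕ) {r : Z → ℝ}
    (hr : Measurable r) {sc : Z → ℕ → ℝ} (hsc : ∀ k, Measurable fun z => sc z k) (l : List ℕ) :
    MeasurableSet {z | (rank ((c, r z) :: idx.map fun k => (k, sc z k))).map Prod.fst = l} := by
  have h1 : Measurable fun z => (Fin.cons (r z) fun i => sc z (idx.get i) :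
      Fin (idx.length + 1) → ℝ) := by
    refine measurable_pi_iff.2 fun k => ?_
    refine Fin.cases ?_ (fun k => ?_) k
    · simpa using hr
    · simpa using hsc _
  have h2 := h1 (hrank.measurable (idx.length + 1) (Fin.cons c idx.get) l)
  have h3 : ∀ z, (List.ofFn fun i : Fin (idx.length + 1) =>
      ((Fin.cons c idx.get : Fin (idx.length + 1) → ℕ) i,
        (Fin.cons (r z) fun i => sc z (idx.get i) : Fin (idx.length + 1) → ℝ) i)) =
      (c, r z) :: idx.map fun k => (k, sc z k) := fun z => by
    rw [List.ofFn_succ]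
    simp only [Fin.cons_zero, Fin.cons_succ]
    congr 1
    conv_rhs => rw [← List.ofFn_get idx, List.map_ofFn]
    rfl
  simpa only [Set.preimage, Set.mem_ofPred_eq, h3] using h2

lemma MeasurableState.step (hrank : IsRanking rank) {σ : Z → AdapState} (hσ : MeasurableState σ)
    {e : Z → Event} (he : Measurable e) :
    MeasurableState fun z =>
      (σ z).step c_rew c_ver rank (e z).getRight? (eventScore (e z)) := by
  obtain ⟨sc, hsc, hpool⟩ := hσ.score
  have hr : Measurable fun z => eventScore (e z) := measurable_eventScore.comp he
  have hpool' : ∀ (s : Shape) (r : ℝ) (z : Z),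
      ∀ p ∈ ((σ z).step c_rew c_ver rank s r).pool,
        (p = ((σ z).count, r) ∧ s = none) ∨ p ∈ (σ z).pool := by
    intro s r z p hp
    rcases s with _ | ⟨i, v⟩
    · rcases List.mem_cons.1 hp with h | h
      · exact .inl ⟨h, rfl⟩
      · exact .inr h
    · right
      have hp' : p ∈ (σ z).pool.filter fun p => p.1 ≠ i := by
        simp only [AdapState.step, AdapState.onLabel] at hp
        split at hp <;> exact hp
      exact List.mem_of_mem_filter hp'
  refine ⟨fun d' => ?_, ⟨fun z k => if (σ z).count = k then eventScore (e z) else sc z k,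
    fun k => ?_, fun z p hp => ?_⟩, fun z p hp => ?_⟩
  · have h1 : ∀ z, σ z = AdapState.ofDisc (σ z).disc (sc z) := fun z =>
      (AdapState.ofDisc_disc (hpool z)).symm
    have h2 : {z | ((σ z).step c_rew c_ver rank (e z).getRight? (eventScore (e z))).disc = d'} =
        {z | ((AdapState.ofDisc (σ z).disc (sc z)).step c_rew c_ver rank
          (e z).getRight? (eventScore (e z))).disc = d'} := by
      ext z
      simp only [Set.mem_ofPred_eq, ← h1 z]
    rw [h2]
    refine measurableSet_of_fiber (f := fun z => (σ z).disc) hσ.disc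
      (Q := fun d z => ((AdapState.ofDisc d (sc z)).step c_rew c_ver rank
          (e z).getRight? (eventScore (e z))).disc = d') fun d => ?_
    refine measurableSet_of_fiber (f := fun z => (e z).getRight?)
      (fun s => he (measurableSet_getRight? s))
      (Q := fun s z => ((AdapState.ofDisc d (sc z)).step c_rew c_ver rank s
          (eventScore (e z))).disc = d') fun s => ?_
    rcases s with _ | ⟨i, v⟩
    · refine measurableSet_of_fiber
        (f := fun z => (rank ((d.2.2.2.1, eventScore (e z)) ::
          d.2.2.2.2.map fun k => (k, sc z k))).map Prod.fst)
        (fun l => measurableSet_rank_map hrank _ _ hr hsc l)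
        (Q := fun l _ => (d.1, d.2.1 - 1, (if d.2.1 ≤ 1 then
          l.take (verBudget c_rew c_ver d.1) else []), d.2.2.2.1 + 1,
            d.2.2.2.1 :: d.2.2.2.2) = d') (fun l => MeasurableSet.const _) |>.congr ?_
      ext z
      simp [AdapState.step, AdapState.onScore, AdapState.disc, AdapState.ofDisc,
        Function.comp_def, List.map_take]
    · have h3 : ∀ z, ((AdapState.ofDisc d (sc z)).step c_rew c_ver rank (some (i, v))
          (eventScore (e z))).disc =
          ((AdapState.ofDisc d fun _ => 0).onLabel c_rew c_ver i).disc := fun z =>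
        AdapState.disc_onLabel_congr (by rw [AdapState.disc_ofDisc, AdapState.disc_ofDisc]) i
      simp only [h3]
      exact MeasurableSet.const _
  · exact Measurable.ite (measurableSet_fiber_comp hσ.disc fun d => d.2.2.2.1 = k) hr (hsc k)
  · rcases hpool' _ _ z p hp with ⟨rfl, -⟩ | h
    · simp
    · simp only [if_neg (hσ.lt_count z p h).ne']
      exact hpool z p h
  · have hcount : (σ z).count + (if (e z).getRight? = none then 1 else 0) =
        ((σ z).step c_rew c_ver rank (e z).getRight? (eventScore (e z))).count := by
      rcases (e z).getRight? with _ | ⟨i, v⟩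
      · rfl
      · rw [if_neg (by simp)]
        simp only [AdapState.step, AdapState.onLabel]
        split <;> rfl
    rw [← hcount]
    rcases hpool' _ _ z p hp with ⟨rfl, h⟩ | h
    · simp [h]
    · exact (hσ.lt_count z p h).trans_le (Nat.le_add_right _ _)

lemma measurableState_adapState (hrank : IsRanking rank) (n : ℕ) (e : Fin n → Z → Event)
    (he : ∀ i, Measurable (e i)) :
    MeasurableState fun z => adapState c_rew c_ver rank (List.ofFn fun i => e i z) := by
  induction n with
  | zero =>
    refine ⟨fun d => ?_, ⟨fun _ _ => 0, fun _ => measurable_const, fun z => ?_⟩, fun z => ?_⟩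
    · simp only [List.ofFn_zero]
      exact MeasurableSet.const _
    · simp [adapState, AdapState.enter]
    · simp [adapState, AdapState.enter]
  | succ n ih =>
    simp_rw [List.ofFn_succ, adapState_cons]
    exact (ih (fun i => e i.succ) fun i => he _).step hrank (he 0)

theorem isSound_adap (hrank : IsRanking rank) : (adap c_rew c_ver rank).IsSound where
  measurable_act n a := by
    have h : MeasurableState fun z : Unit × (Fin n → Event) =>
        adapState c_rew c_ver rank (List.ofFn fun i => z.2 i) :=
      measurableState_adapState hrank n (fun i (z : Unit × (Fin n → Event)) => z.2 i)
        fun i => (measurable_pi_apply i).comp measurable_snd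
    have h' := measurableSet_fiber_comp h.disc fun d =>
      (match d.2.2.1 with
        | i :: _ => Action.verify i
        | [] => Action.generate) = a
    exact h'
  verify_mem_pool := adap_verify_mem_pool hrank

end Measurability

/-! ### The probability that a shell fails -/

section Failure

/-- In a list along which `f ≤ 1` increases, the product of the first `k` values is at most the
product over any sublist of length at most `k`. -/
lemma prod_take_le_prod_of_sublist {α : Type*} {f : α → ℝ≥0∞} (hf : ∀ a, f a ≤ 1) {L : List α}
    (hL : L.Pairwise fun a b => f a ≤ f b) {Q : List α} (hQ : Q.Sublist L) {k : ℕ}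
    (hk : Q.length ≤ k) : ((L.take k).map f).prod ≤ (Q.map f).prod := by
  induction L generalizing Q k with
  | nil => simp [List.sublist_nil.1 hQ]
  | cons x L ih =>
    obtain ⟨hx, hL⟩ := List.pairwise_cons.1 hL
    rcases k with _ | k
    · simp [List.length_eq_zero_iff.1 (Nat.le_zero.1 hk)]
    · rw [List.take_succ_cons, List.map_cons, List.prod_cons]
      cases hQ with
      | cons _ hQ =>
        rcases Q with _ | ⟨y, Q⟩
        · calc f x * ((L.take k).map f).prod ≤ 1 * (([] : List α).map f).prod :=
                mul_le_mul' (hf x) (ih hL (List.nil_sublist _) (Nat.zero_le _))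
            _ = _ := by simp
        · rw [List.map_cons, List.prod_cons]
          exact mul_le_mul' (hx y (hQ.subset List.mem_cons_self))
            (ih hL ((List.sublist_cons_self y Q).trans hQ) (by simpa using hk))
      | cons_cons _ hQ =>
        rw [List.map_cons, List.prod_cons]
        exact mul_le_mul_right (ih hL hQ (by simpa using hk)) _

variable {c_rew c_ver : ℝ} {rank : List (ℕ × ℝ) → List (ℕ × ℝ)}

open Classical in
/-- A bound for the probability that no label is positive when the top `k` of a pool are verified
which contains the candidates `c, …, c + m - 1`. The first term is the probability that all of
those among them with score in `T` have negative labels, the second one takes care of the case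
that there are more than `k` of these. -/
noncomputable def failBound (g : ℝ → ℝ≥0∞) (T : Set ℝ) (c m k : ℕ) (R : ℕ → ℝ) : ℝ≥0∞ :=
  (∏ i ∈ Finset.Ico c (c + m), if R i ∈ T then g (R i) else 1) +
    ((2 : ℝ≥0∞) ^ k)⁻¹ * ∏ i ∈ Finset.Ico c (c + m), if R i ∈ T then 2 else 1

lemma prod_top_le_failBound (hrank : IsRanking rank) {g : ℝ → ℝ≥0∞} (hg : Antitone g)
    (hg1 : ∀ r, g r ≤ 1) (T : Set ℝ) {R : ℕ → ℝ} {P : List (ℕ × ℝ)}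
    (hscore : ∀ p ∈ P, p.2 = R p.1) (hnodup : (P.map Prod.fst).Nodup) {c m k K : ℕ}
    (hkK : k ≤ K) (hP : ∀ i, c ≤ i → i < c + m → (i, R i) ∈ P) :
    ((((rank P).take K).map Prod.fst).map fun i => g (R i)).prod ≤ failBound g T c m k R := by
  classical
  set B := (Finset.Ico c (c + m)).filter fun i => R i ∈ T with hB
  have ha : (∏ i ∈ Finset.Ico c (c + m), if R i ∈ T then g (R i) else 1) =
      ∏ i ∈ B, g (R i) := by rw [hB, Finset.prod_filter]
  have hb : (∏ i ∈ Finset.Ico c (c + m), if R i ∈ T then (2 : ℝ≥0∞) else 1) = 2 ^ B.card := by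
    rw [← Finset.prod_filter, Finset.prod_const]
  unfold failBound
  rw [ha, hb]
  rcases le_or_gt B.card k with hk | hk
  -- the candidates in `B` form a sublist of the ranked pool, to which the exchange lemma applies
  · refine le_add_right ?_
    set L := (rank P).map Prod.fst with hL
    have hLP : L.Perm (P.map Prod.fst) := (hrank.perm P).map _
    have hmem : ∀ p ∈ rank P, p.2 = R p.1 := fun p hp =>
      hscore p ((hrank.perm P).mem_iff.1 hp)
    have hsorted : L.Pairwise fun i j => g (R i) ≤ g (R j) := by
      rw [hL, List.pairwise_map]
      refine List.Pairwise.imp_of_mem ?_ (hrank.sorted P)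
      intro p q hp hq h
      rw [← hmem p hp, ← hmem q hq]
      exact hg h
    have hQB : (L.filter (· ∈ B)).toFinset = B := by
      ext i
      simp only [List.mem_toFinset, List.mem_filter, decide_eq_true_eq, and_iff_right_iff_imp]
      intro hi
      have hi' := Finset.mem_Ico.1 (Finset.mem_filter.1 hi).1
      exact hLP.mem_iff.2 (List.mem_map.2 ⟨_, hP i hi'.1 hi'.2, rfl⟩)
    have hQn : (L.filter (· ∈ B)).Nodup := (hLP.nodup_iff.2 hnodup).filter _
    have hprod : ((L.filter (· ∈ B)).map fun i => g (R i)).prod = ∏ i ∈ B, g (R i) := by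
      rw [← List.prod_toFinset _ hQn, hQB]
    rw [← hprod, List.map_take]
    refine prod_take_le_prod_of_sublist (fun i => hg1 (R i)) hsorted List.filter_sublist ?_
    rw [← List.toFinset_card_of_nodup hQn, hQB]
    exact hk.trans hkK
  -- here the second term is at least `2 ^ B.card / 2 ^ k ≥ 1`
  · refine le_add_left ((prod_map_le_one hg1 _).trans ?_)
    rw [← ENNReal.inv_mul_cancel (a := 2 ^ k) (by simp) (by finiteness)]
    gcongr
    · exact one_le_two

/-- The bound for the probability of reaching shell `s` that results from the failures of the
shells from `s₀` on, where `(a, b)` is in shell `s₀`. -/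
noncomputable def reachBound (c_rew c_ver : ℝ) (g : ℝ → ℝ≥0∞) (T : Set ℝ) (a b s₀ : ℕ)
    (R : ℕ → ℝ) (s : ℕ) : ℝ≥0∞ :=
  ∏ t ∈ Finset.Ico s₀ s, failBound g T (genBefore c_rew c_ver t) (2 ^ (b + (t - s₀) + 1))
    (6 * 2 ^ (b + (t - s₀) - a)) R

lemma reachBound_of_le {g : ℝ → ℝ≥0∞} {T : Set ℝ} {a b s₀ s : ℕ} {R : ℕ → ℝ} (h : s ≤ s₀) :
    reachBound c_rew c_ver g T a b s₀ R s = 1 := by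
  simp [reachBound, Finset.Ico_eq_empty_of_le h]

lemma reachBound_succ {g : ℝ → ℝ≥0∞} {T : Set ℝ} {a b s₀ s : ℕ} {R : ℕ → ℝ} (h : s₀ ≤ s) :
    reachBound c_rew c_ver g T a b s₀ R (s + 1) =
      reachBound c_rew c_ver g T a b s₀ R s *
        failBound g T (genBefore c_rew c_ver s) (2 ^ (b + (s - s₀) + 1))
          (6 * 2 ^ (b + (s - s₀) - a)) R := by
  rw [reachBound, Finset.prod_Ico_succ_top h, reachBound]

lemma mem_shell_of_le {a b s₀ s : ℕ} (h : (a, b) ∈ shell c_rew c_ver s₀) (hs : s₀ ≤ s) :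
    (a, b + (s - s₀)) ∈ shell c_rew c_ver s := by
  have := add_mem_shell h (s - s₀)
  rwa [Nat.add_sub_cancel' hs] at this

lemma genBefore_add_le (hrew : 0 < c_rew) (hver : 0 < c_ver) {a b s₀ s : ℕ}
    (h : (a, b) ∈ shell c_rew c_ver s₀) (hs : s₀ ≤ s) :
    genBefore c_rew c_ver s + 2 ^ (b + (s - s₀) + 1) ≤ genBefore c_rew c_ver (s + 1) := by
  rw [genBefore_succ ⟨_, mem_shell_of_le h hs⟩]
  exact Nat.add_le_add_left (le_genBudget hrew hver (mem_shell_of_le h hs)) _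

lemma isDecay_reachBound (hrew : 0 < c_rew) (hver : 0 < c_ver) (hrank : IsRanking rank)
    {g : ℝ → ℝ≥0∞} (hg : Antitone g) (hg1 : ∀ r, g r ≤ 1) (T : Set ℝ) {a b s₀ : ℕ}
    (h : (a, b) ∈ shell c_rew c_ver s₀) (R : ℕ → ℝ) :
    IsDecay c_rew c_ver rank g R (reachBound c_rew c_ver g T a b s₀ R) where
  le_one := hg1
  start := (reachBound_of_le (nextShell_le (Nat.zero_le _) ⟨_, h⟩)).ge
  step s P _ hP := by
    rcases le_or_gt s₀ s with hs | hs
    · have hnext : nextShell c_rew c_ver (s + 1) = s + 1 :=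
        le_antisymm (nextShell_le le_rfl ⟨_, mem_shell_of_le h (hs.trans s.le_succ)⟩)
          (nextShell_spec hrew hver _).1
      rw [hnext, reachBound_succ hs]
      refine (min_le_right _ _).trans (mul_le_mul_right ?_ _)
      refine prod_top_le_failBound hrank hg hg1 T hP.score hP.nodup
        (le_verBudget hrew hver (mem_shell_of_le h hs)) fun i h1 h2 => hP.fresh i h1 ?_
      exact h2.trans_le (genBefore_add_le hrew hver h hs)
    · rw [reachBound_of_le (nextShell_le hs ⟨_, h⟩)]
      exact min_le_left _ _

lemma failBound_congr {g : ℝ → ℝ≥0∞} {T : Set ℝ} {c m k : ℕ} {R R' : ℕ → ℝ}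
    (h : ∀ i < c + m, R i = R' i) : failBound g T c m k R = failBound g T c m k R' := by
  unfold failBound
  congr 1
  · exact Finset.prod_congr rfl fun i hi => by rw [h i (Finset.mem_Ico.1 hi).2]
  · congr 1
    exact Finset.prod_congr rfl fun i hi => by rw [h i (Finset.mem_Ico.1 hi).2]

lemma genBefore_mono : Monotone (genBefore c_rew c_ver) := fun _ _ h =>
  Finset.sum_le_sum_of_subset (Finset.range_subset_range.2 h)

lemma reachBound_congr (hrew : 0 < c_rew) (hver : 0 < c_ver) {g : ℝ → ℝ≥0∞} {T : Set ℝ}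
    {a b s₀ s : ℕ} (h : (a, b) ∈ shell c_rew c_ver s₀) {R R' : ℕ → ℝ}
    (hR : ∀ i < genBefore c_rew c_ver s, R i = R' i) :
    reachBound c_rew c_ver g T a b s₀ R s = reachBound c_rew c_ver g T a b s₀ R' s := by
  refine Finset.prod_congr rfl fun t ht => failBound_congr fun i hi => hR i ?_
  obtain ⟨h1, h2⟩ := Finset.mem_Ico.1 ht
  exact hi.trans_le ((genBefore_add_le hrew hver h h1).trans (genBefore_mono h2))

lemma measurable_failBound {g : ℝ → ℝ≥0∞} (hg : Measurable g) {T : Set ℝ}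
    (hT : MeasurableSet T) (c m k : ℕ) : Measurable (failBound g T c m k) := by
  refine Measurable.add ?_ (Measurable.const_mul ?_ _)
  · exact Finset.measurable_prod _ fun i _ => Measurable.ite (measurable_pi_apply i hT)
      (hg.comp (measurable_pi_apply i)) measurable_const
  · exact Finset.measurable_prod _ fun i _ => Measurable.ite (measurable_pi_apply i hT)
      measurable_const measurable_const

lemma measurable_reachBound {g : ℝ → ℝ≥0∞} (hg : Measurable g) {T : Set ℝ}
    (hT : MeasurableSet T) (a b s₀ s : ℕ) :
    Measurable fun R => reachBound c_rew c_ver g T a b s₀ R s :=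
  Finset.measurable_prod _ fun _ _ => measurable_failBound hg hT _ _ _

/-- The scores of a stream of candidates. -/
def scores (ω : ℕ → ℝ × Bool) : ℕ → ℝ := fun j => (ω j).1

lemma measurable_scores : Measurable scores :=
  measurable_pi_iff.2 fun j => measurable_fst.comp (measurable_pi_apply j)

lemma lintegral_mul_failBound (I : SearchInstance) {F : (ℕ → ℝ × Bool) → ℝ≥0∞}
    (hF : Measurable F) {c : ℕ} (hFc : ∀ ω x i, c ≤ i → F (Function.update ω i x) = F ω)
    {g : ℝ → ℝ≥0∞} (hg : Measurable g) {T : Set ℝ} (hT : MeasurableSet T) (m k : ℕ) :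
    ∫⁻ ω, F ω * failBound g T c m k (scores ω) ∂I.streamLaw =
      (∫⁻ ω, F ω ∂I.streamLaw) * ((∫⁻ r in T, g r ∂I.D + I.D Tᶜ) ^ m +
        ((2 : ℝ≥0∞) ^ k)⁻¹ * (1 + I.D T) ^ m) := by
  classical
  have ma : Measurable fun r => if r ∈ T then g r else 1 := Measurable.ite hT hg measurable_const
  have mb : Measurable fun r => if r ∈ T then (2 : ℝ≥0∞) else 1 :=
    Measurable.ite hT measurable_const measurable_const
  have ea : ∫⁻ r, (if r ∈ T then g r else 1) ∂I.D = ∫⁻ r in T, g r ∂I.D + I.D Tᶜ := by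
    rw [← lintegral_add_compl _ hT]
    congr 1
    · exact setLIntegral_congr_fun hT fun r hr => if_pos hr
    · rw [setLIntegral_congr_fun (g := fun _ => 1) hT.compl fun r hr => if_neg hr]
      simp
  have eb : ∫⁻ r, (if r ∈ T then (2 : ℝ≥0∞) else 1) ∂I.D = 1 + I.D T := by
    have : ∀ r, (if r ∈ T then (2 : ℝ≥0∞) else 1) = 1 + T.indicator 1 r := fun r => by
      by_cases hr : r ∈ T
      · simp [hr, one_add_one_eq_two]
      · simp [hr]
    simp_rw [this]
    rw [lintegral_add_left measurable_const, lintegral_indicator_one hT]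
    simp
  have hma : Measurable fun ω : ℕ → ℝ × Bool => F ω *
      ∏ i ∈ Finset.Ico c (c + m), (fun z : ℝ × Bool => if z.1 ∈ T then g z.1 else 1) (ω i) :=
    hF.mul (measurable_prod_coord (g := fun z : ℝ × Bool => if z.1 ∈ T then g z.1 else 1)
      (ma.comp measurable_fst) _)
  have hmb : Measurable fun ω : ℕ → ℝ × Bool => F ω *
      ∏ i ∈ Finset.Ico c (c + m), (fun z : ℝ × Bool => if z.1 ∈ T then (2 : ℝ≥0∞) else 1) (ω i) :=
    hF.mul (measurable_prod_coord (g := fun z : ℝ × Bool => if z.1 ∈ T then (2 : ℝ≥0∞) else 1)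
      (mb.comp measurable_fst) _)
  have e : ∀ ω : ℕ → ℝ × Bool, F ω * failBound g T c m k (scores ω) =
      F ω * ∏ i ∈ Finset.Ico c (c + m), (fun z : ℝ × Bool => if z.1 ∈ T then g z.1 else 1) (ω i) +
      ((2 : ℝ≥0∞) ^ k)⁻¹ * (F ω *
        ∏ i ∈ Finset.Ico c (c + m),
          (fun z : ℝ × Bool => if z.1 ∈ T then (2 : ℝ≥0∞) else 1) (ω i)) := fun ω => by
    rw [failBound, mul_add, mul_left_comm]
    rfl
  simp_rw [e]
  rw [lintegral_add_left hma, lintegral_const_mul _ hmb,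
    lintegral_mul_prod_block I.pairLaw c m hF hFc
      (g := fun z : ℝ × Bool => if z.1 ∈ T then g z.1 else 1) (ma.comp measurable_fst),
    lintegral_mul_prod_block I.pairLaw c m hF hFc
      (g := fun z : ℝ × Bool => if z.1 ∈ T then (2 : ℝ≥0∞) else 1) (mb.comp measurable_fst),
    I.lintegral_pairLaw_fst ma, I.lintegral_pairLaw_fst mb, ea, eb]
  ring

/-- If every shell from `s₀` on fails with probability at most `q`, then the probability of
reaching shell `s` decays geometrically. -/
lemma lintegral_reachBound_le (hrew : 0 < c_rew) (hver : 0 < c_ver) (I : SearchInstance)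
    {g : ℝ → ℝ≥0∞} (hg : Measurable g) {T : Set ℝ} (hT : MeasurableSet T) {a b s₀ : ℕ}
    (h : (a, b) ∈ shell c_rew c_ver s₀) {q : ℝ≥0∞}
    (hq : ∀ t, (∫⁻ r in T, g r ∂I.D + I.D Tᶜ) ^ 2 ^ (b + t + 1) +
        ((2 : ℝ≥0∞) ^ (6 * 2 ^ (b + t - a)))⁻¹ * (1 + I.D T) ^ 2 ^ (b + t + 1) ≤ q) (s : ℕ) :
    ∫⁻ ω, reachBound c_rew c_ver g T a b s₀ (scores ω) s ∂I.streamLaw ≤ q ^ (s - s₀) := by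
  rcases le_total s s₀ with hs | hs
  · simp [reachBound_of_le hs, Nat.sub_eq_zero_of_le hs]
  induction s, hs using Nat.le_induction with
  | base => simp [reachBound_of_le le_rfl]
  | succ s hs ih =>
    simp_rw [reachBound_succ hs]
    rw [lintegral_mul_failBound I
      (F := fun ω => reachBound c_rew c_ver g T a b s₀ (scores ω) s) ((measurable_reachBound hg hT a b s₀ s).comp measurable_scores)
      ?_ hg hT, Nat.succ_sub hs, pow_succ q]
    · exact mul_le_mul' ih (hq _)
    · intro ω x i hi
      refine reachBound_congr hrew hver h fun j hj => ?_
      simp only [scores]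
      rw [Function.update_of_ne (by omega)]

end Failure

/-! ### The expected cost of the shellwise policy -/

section ExpectedCost

/-- The probability of a negative label at a given score. -/
noncomputable def SearchInstance.negProb (I : SearchInstance) (r : ℝ) : ℝ≥0∞ :=
  ENNReal.ofReal (1 - I.h r)

lemma SearchInstance.measurable_negProb (I : SearchInstance) : Measurable I.negProb := by
  have := I.measurable_h
  unfold SearchInstance.negProb
  fun_prop

lemma SearchInstance.negProb_le_one (I : SearchInstance) (r : ℝ) : I.negProb r ≤ 1 := by
  rw [← I.ofReal_h_add r]
  exact le_add_self

lemma SearchInstance.antitone_negProb {I : SearchInstance} (hI : Monotone I.h) :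
    Antitone I.negProb := fun _ _ h =>
  ENNReal.ofReal_le_ofReal (sub_le_sub_left (hI h) 1)

lemma measurable_map_prod {g : ℝ → ℝ≥0∞} (hg : Measurable g) (l : List ℕ) :
    Measurable fun R : ℕ → ℝ => (l.map fun i => g (R i)).prod := by
  induction l with
  | nil => simp
  | cons i l ih =>
    simp only [List.map_cons, List.prod_cons]
    exact (hg.comp (measurable_pi_apply i)).mul ih

lemma measurable_ite_labels_false (l : List ℕ) : Measurable fun ω : ℕ → ℝ × Bool =>
    if ∀ i ∈ l, (ω i).2 = false then (1 : ℝ≥0∞) else 0 := by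
  refine Measurable.ite ?_ measurable_const measurable_const
  have : {ω : ℕ → ℝ × Bool | ∀ i ∈ l, (ω i).2 = false} =
      ⋂ i ∈ {i | i ∈ l}, {ω : ℕ → ℝ × Bool | (ω i).2 = false} := by
    ext ω
    simp
  rw [this]
  exact MeasurableSet.biInter (Set.to_countable _) fun i _ =>
    (measurable_snd.comp (measurable_pi_apply i)) (measurableSet_singleton false)

/-- Given the scores, the labels of distinct candidates are independent. -/
lemma lintegral_mul_labels_false (I : SearchInstance) {l : List ℕ} (hl : l.Nodup)
    {F : (ℕ → ℝ) → ℝ≥0∞} (hF : Measurable F) :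
    ∫⁻ ω, F (scores ω) * (if ∀ i ∈ l, (ω i).2 = false then 1 else 0) ∂I.streamLaw =
      ∫⁻ ω, F (scores ω) * (l.map fun i => I.negProb (scores ω i)).prod ∂I.streamLaw := by
  induction l generalizing F with
  | nil => simp
  | cons i l ih =>
    obtain ⟨hil, hl⟩ := List.nodup_cons.1 hl
    have e1 : ∀ ω : ℕ → ℝ × Bool,
        F (scores ω) * (if ∀ j ∈ i :: l, (ω j).2 = false then 1 else 0) =
        (F (scores ω) * (if ∀ j ∈ l, (ω j).2 = false then 1 else 0)) *
          (if (ω i).2 = false then 1 else 0) := fun ω => by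
      by_cases h1 : (ω i).2 = false <;> simp [h1]
    simp_rw [e1]
    rw [I.lintegral_mul_label i
      (F := fun ω => F (scores ω) * (if ∀ j ∈ l, (ω j).2 = false then 1 else 0))
      ((hF.comp measurable_scores).mul (measurable_ite_labels_false l)) ?_
      (fun v => if v = false then 1 else 0)]
    · have e2 : ∀ ω : ℕ → ℝ × Bool,
          F (scores ω) * (if ∀ j ∈ l, (ω j).2 = false then 1 else 0) *
            (ENNReal.ofReal (I.h (ω i).1) * (if true = false then 1 else 0) +
              ENNReal.ofReal (1 - I.h (ω i).1) * (if false = false then 1 else 0)) =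
          (F (scores ω) * I.negProb (scores ω i)) *
            (if ∀ j ∈ l, (ω j).2 = false then 1 else 0) := fun ω => by
        simp only [Bool.true_eq_false, if_false, if_true, mul_zero, zero_add, mul_one]
        rw [mul_right_comm]
        rfl
      refine (lintegral_congr e2).trans ?_
      rw [ih hl (F := fun R => F R * I.negProb (R i))
        (hF.mul (I.measurable_negProb.comp (measurable_pi_apply i)))]
      simp only [List.map_cons, List.prod_cons, mul_assoc]
    · intro ω v
      have h1 : scores (Function.update ω i ((ω i).1, v)) = scores ω := by
        funext j
        by_cases hj : j = i
        · subst hj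
          simp [scores]
        · simp [scores, Function.update_of_ne hj]
      have h2 : ∀ j ∈ l, Function.update ω i ((ω i).1, v) j = ω j := fun j hj =>
        Function.update_of_ne (fun e : j = i => hil (e ▸ hj)) _ _
      simp only [h1]
      congr 2
      exact propext (forall₂_congr fun j hj => by rw [h2 j hj])

/-- The same for a set of candidates that is chosen as a function of the scores. -/
lemma lintegral_mul_chosen_labels_false (I : SearchInstance) {W : (ℕ → ℝ) → List ℕ}
    (hW : ∀ l, MeasurableSet {R | W R = l}) (hWn : ∀ R, (W R).Nodup)
    {F : (ℕ → ℝ) → ℝ≥0∞} (hF : Measurable F) :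
    ∫⁻ ω, F (scores ω) * (if ∀ i ∈ W (scores ω), (ω i).2 = false then 1 else 0)
        ∂I.streamLaw =
      ∫⁻ ω, F (scores ω) * ((W (scores ω)).map fun i => I.negProb (scores ω i)).prod
        ∂I.streamLaw := by
  have hFl : ∀ l, Measurable fun R => if W R = l then F R else 0 := fun l =>
    Measurable.ite (hW l) hF measurable_const
  have split : ∀ (G : List ℕ → (ℕ → ℝ × Bool) → ℝ≥0∞) (ω : ℕ → ℝ × Bool),
      F (scores ω) * G (W (scores ω)) ω =
        ∑' l, (if W (scores ω) = l then F (scores ω) else 0) * G l ω := fun G ω => by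
    rw [tsum_eq_single (W (scores ω)) fun l hl => by rw [if_neg hl.symm, zero_mul], if_pos rfl]
  have h1 : ∀ l, Measurable fun ω : ℕ → ℝ × Bool =>
      (if W (scores ω) = l then F (scores ω) else 0) *
        (if ∀ i ∈ l, (ω i).2 = false then 1 else 0) := fun l =>
    ((hFl l).comp measurable_scores).mul (measurable_ite_labels_false l)
  have h2 : ∀ l, Measurable fun ω : ℕ → ℝ × Bool =>
      (if W (scores ω) = l then F (scores ω) else 0) *
        (l.map fun i => I.negProb (scores ω i)).prod := fun l =>
    ((hFl l).comp measurable_scores).mul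
      ((measurable_map_prod I.measurable_negProb l).comp measurable_scores)
  rw [lintegral_congr (split fun l ω => if ∀ i ∈ l, (ω i).2 = false then 1 else 0),
    lintegral_congr (split fun l ω => (l.map fun i => I.negProb (scores ω i)).prod),
    lintegral_tsum fun l => (h1 l).aemeasurable, lintegral_tsum fun l => (h2 l).aemeasurable]
  congr 1
  funext l
  by_cases hl : l.Nodup
  · exact lintegral_mul_labels_false I hl (hFl l)
  · have : ∀ R, W R ≠ l := fun R h => hl (h ▸ hWn R)
    simp [this]

variable {c_rew c_ver : ℝ} {rank : List (ℕ × ℝ) → List (ℕ × ℝ)}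

lemma measurable_unit_negStream :
    Measurable fun R : ℕ → ℝ => ((() : Unit), negStream R) :=
  measurable_const.prodMk measurable_negStream

lemma measurable_stepCost_adapRun (hrank : IsRanking rank) (n : ℕ) :
    Measurable fun R : ℕ → ℝ => stepCost c_rew c_ver
      ((adap c_rew c_ver rank).act () (adapRun c_rew c_ver rank R n)) :=
  measurable_of_fiber (G := fun a _ => stepCost c_rew c_ver a)
    (fun a => measurable_unit_negStream
      (measurableSet_act_history _ (isSound_adap hrank).measurable_act n a))
    fun _ => measurable_const

lemma measurableSet_verified_adapRun (hrank : IsRanking rank) (n : ℕ) (l : List ℕ) :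
    MeasurableSet {R : ℕ → ℝ | verified (adapRun c_rew c_ver rank R n) = l} :=
  measurable_unit_negStream (measurableSet_history_of_shapes (adap c_rew c_ver rank)
    (isSound_adap hrank).measurable_act n fun l' => l'.filterMap (Option.map Prod.fst) = l)

lemma measurable_cost_adap (hrew : 0 < c_rew) (hver : 0 < c_ver) (hrank : IsRanking rank) :
    Measurable ((adap c_rew c_ver rank).cost c_rew c_ver ()) :=
  ((isSound_adap hrank).measurable_cost hrew hver).comp
    (g := fun z : Unit × (ℕ → ℝ × Bool) => (adap c_rew c_ver rank).cost c_rew c_ver z.1 z.2)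
    measurable_prodMk_left

lemma expectedCost_adap_eq_lintegral (hrew : 0 < c_rew) (hver : 0 < c_ver)
    (hrank : IsRanking rank) (ρ : Measure (ℕ → ℝ × Bool)) [SFinite ρ] :
    (adap c_rew c_ver rank).expectedCost c_rew c_ver ρ =
      ∫⁻ ω, (adap c_rew c_ver rank).cost c_rew c_ver () ω ∂ρ := by
  have hm := measurable_cost_adap hrew hver hrank
  obtain ⟨J, hJ⟩ : ∃ J, J = (adap c_rew c_ver rank).cost c_rew c_ver () := ⟨_, rfl⟩
  have hprod : (adap c_rew c_ver rank).expectedCost c_rew c_ver ρ =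
      ∫⁻ z : Unit × (ℕ → ℝ × Bool), J z.2 ∂((Measure.dirac ()).prod ρ) := by
    rw [hJ]
    rfl
  rw [← hJ] at hm ⊢
  rw [hprod, Measure.dirac_prod, lintegral_map (f := fun z : Unit × (ℕ → ℝ × Bool) => J z.2)
    (hm.comp measurable_snd) measurable_prodMk_left]

/-- The expected cost of the policy is at most the price of all shells, each weighted by a bound
for the probability that it is reached. -/
lemma expectedCost_adap_le (hrew : 0 < c_rew) (hver : 0 < c_ver) (hrank : IsRanking rank)
    (I : SearchInstance) {Y : (ℕ → ℝ) → ℕ → ℝ≥0∞} (hYm : ∀ s, Measurable fun R => Y R s)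
    (hY : ∀ R, IsDecay c_rew c_ver rank I.negProb R (Y R)) :
    (adap c_rew c_ver rank).expectedCost c_rew c_ver I.streamLaw ≤
      ∑' s, shellPrice c_rew c_ver s * ∫⁻ ω, Y (scores ω) s ∂I.streamLaw := by
  set A := adap c_rew c_ver rank with hA
  let F : ℕ → (ℕ → ℝ) → ℝ≥0∞ := fun n R =>
    stepCost c_rew c_ver (A.act () (adapRun c_rew c_ver rank R n))
  let W : ℕ → (ℕ → ℝ) → List ℕ := fun n R => verified (adapRun c_rew c_ver rank R n)
  have hF : ∀ n, Measurable (F n) := fun n => measurable_stepCost_adapRun hrank n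
  have hW : ∀ n l, MeasurableSet {R | W n R = l} := fun n l =>
    measurableSet_verified_adapRun hrank n l
  have hcost : ∀ ω : ℕ → ℝ × Bool, A.cost c_rew c_ver () ω =
      ∑' n, F n (scores ω) * if ∀ i ∈ W n (scores ω), (ω i).2 = false then 1 else 0 := fun ω => by
    rw [cost_eq_tsum_negStream A () hrew hver]
    congr 1
  have hm1 : ∀ n, Measurable fun ω : ℕ → ℝ × Bool =>
      F n (scores ω) * if ∀ i ∈ W n (scores ω), (ω i).2 = false then (1 : ℝ≥0∞) else 0 :=
    fun n => ((hF n).comp measurable_scores).mul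
      (measurable_of_fiber (f := fun ω => W n (scores ω))
        (G := fun l ω => if ∀ i ∈ l, (ω i).2 = false then (1 : ℝ≥0∞) else 0)
        (fun l => measurable_scores (hW n l)) measurable_ite_labels_false)
  have hm2 : ∀ n, Measurable fun ω : ℕ → ℝ × Bool =>
      F n (scores ω) * ((W n (scores ω)).map fun i => I.negProb (scores ω i)).prod :=
    fun n => ((hF n).comp measurable_scores).mul
      (measurable_of_fiber (f := fun ω => W n (scores ω))
        (G := fun l ω => (l.map fun i => I.negProb (scores ω i)).prod)
        (fun l => measurable_scores (hW n l))
        fun l => (measurable_map_prod I.measurable_negProb l).comp measurable_scores)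
  rw [expectedCost_adap_eq_lintegral hrew hver hrank]
  calc ∫⁻ ω, A.cost c_rew c_ver () ω ∂I.streamLaw
      = ∑' n, ∫⁻ ω, F n (scores ω) *
          (if ∀ i ∈ W n (scores ω), (ω i).2 = false then 1 else 0) ∂I.streamLaw := by
        rw [← lintegral_tsum fun n => (hm1 n).aemeasurable]
        exact lintegral_congr hcost
    _ = ∑' n, ∫⁻ ω, F n (scores ω) *
          ((W n (scores ω)).map fun i => I.negProb (scores ω i)).prod ∂I.streamLaw := by
        congr 1
        funext n
        exact lintegral_mul_chosen_labels_false I (hW n)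
          (fun R => (consistent_adapRun hrank R n).nodup_verified) (hF n)
    _ = ∫⁻ ω, ∑' n, F n (scores ω) *
          ((W n (scores ω)).map fun i => I.negProb (scores ω i)).prod ∂I.streamLaw :=
        (lintegral_tsum fun n => (hm2 n).aemeasurable).symm
    _ ≤ ∫⁻ ω, ∑' s, shellPrice c_rew c_ver s * Y (scores ω) s ∂I.streamLaw :=
        lintegral_mono fun ω => tsum_stepCost_mul_verifiedProd_le hrew hver hrank (hY (scores ω))
    _ = _ := by
        have hYs : ∀ s, Measurable fun ω : ℕ → ℝ × Bool => Y (scores ω) s := fun s =>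
          (hYm s).comp measurable_scores
        rw [lintegral_tsum fun s => ((hYs s).const_mul _).aemeasurable]
        congr 1
        funext s
        exact lintegral_const_mul _ (hYs s)

end ExpectedCost

/-! ### The optimal threshold and its dyadic scales -/

section Threshold

/-- There is a value `lam` of a positive label at which generating a candidate, and verifying it
only if its score is in the profitable set `T`, exactly breaks even. In terms of the mass `p` of
`T` and the probability `G` that a candidate is in `T` and has a positive label, this says
`lam * G = c_rew + c_ver * p`. -/
lemma exists_threshold {c_rew c_ver : ℝ} (hrew : 0 < c_rew) (hver : 0 < c_ver)
    (I : SearchInstance) (hI : 0 < ∫ r, I.h r ∂I.D) :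
    ∃ (lam p G : ℝ) (T : Set ℝ), 0 < lam ∧ MeasurableSet T ∧ 0 < G ∧ G ≤ p ∧ p ≤ 1 ∧
      I.D T = ENNReal.ofReal p ∧
      ∫⁻ r in T, ENNReal.ofReal (1 - I.h r) ∂I.D + I.D Tᶜ = ENNReal.ofReal (1 - G) ∧
      lam * G = c_rew + c_ver * p ∧
      ∫⁻ r, ENNReal.ofReal (lam * I.h r - c_ver) ∂I.D ≤ ENNReal.ofReal c_rew := by
  have hm := I.measurable_h
  have h0 := fun r => (I.h_mem r).1
  have h1 := fun r => (I.h_mem r).2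
  have hint : Integrable I.h I.D := Integrable.of_bound hm.aestronglyMeasurable 1
    (.of_forall fun r => by rw [Real.norm_of_nonneg (h0 r)]; exact h1 r)
  set ψ : ℝ → ℝ := fun lam => ∫ r, max (lam * I.h r - c_ver) 0 ∂I.D with hψ
  have hψint : ∀ lam, Integrable (fun r => max (lam * I.h r - c_ver) 0) I.D := fun lam =>
    ((hint.const_mul lam).sub (integrable_const _)).sup (integrable_zero _ _ _)
  -- the intermediate value theorem on `[0, M]`, where `M * ∫ h - c_ver = c_rew`
  set M := (c_rew + c_ver) / ∫ r, I.h r ∂I.D with hM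
  have hM0 : 0 < M := by positivity
  have hcont : ContinuousOn ψ (Set.Icc 0 M) := by
    refine continuousOn_of_dominated (bound := fun _ => M) (fun lam _ => by fun_prop)
      (fun lam hlam => .of_forall fun r => ?_) (integrable_const _)
      (.of_forall fun r => by fun_prop)
    rw [Real.norm_of_nonneg (le_max_right _ _)]
    refine max_le ?_ hM0.le
    have := mul_le_mul hlam.2 (h1 r) (h0 r) hM0.le
    linarith
  have hψ0 : ψ 0 = 0 := by
    simp [hψ, hver.le]
  have hψM : c_rew ≤ ψ M := by
    have : ∫ r, (M * I.h r - c_ver) ∂I.D ≤ ψ M :=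
      integral_mono ((hint.const_mul M).sub (integrable_const _)) (hψint M)
        fun r => le_max_left _ _
    rw [integral_sub (hint.const_mul M) (integrable_const _), integral_const_mul, hM,
      div_mul_cancel₀ _ hI.ne'] at this
    simpa using this
  obtain ⟨lam, hlam, hlamψ⟩ := intermediate_value_Icc hM0.le hcont
    (show c_rew ∈ Set.Icc (ψ 0) (ψ M) from ⟨by rw [hψ0]; exact hrew.le, hψM⟩)
  have hlam0 : 0 < lam := by
    refine lt_of_le_of_ne hlam.1 fun h => ?_
    rw [← h, hψ0] at hlamψ
    exact hrew.ne hlamψ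
  set T : Set ℝ := {r | c_ver < lam * I.h r} with hT
  have hTm : MeasurableSet T := measurableSet_lt measurable_const (hm.const_mul _)
  set p := I.D.real T with hp
  set G := ∫ r in T, I.h r ∂I.D with hG
  have hbal : lam * G = c_rew + c_ver * p := by
    have e : ∀ r, max (lam * I.h r - c_ver) 0 =
        T.indicator (fun r => lam * I.h r - c_ver) r := fun r => by
      by_cases hr : r ∈ T
      · rw [Set.indicator_of_mem hr]
        exact max_eq_left (sub_nonneg.2 (le_of_lt hr))
      · rw [Set.indicator_of_notMem hr]
        exact max_eq_right (sub_nonpos.2 (not_lt.1 hr))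
    have : ψ lam = lam * G - c_ver * p := by
      simp only [hψ, e]
      rw [integral_indicator hTm, integral_sub (hint.const_mul lam).integrableOn
        (integrable_const _), integral_const_mul, setIntegral_const, smul_eq_mul, mul_comm p]
    linarith
  have hp0 : 0 ≤ p := measureReal_nonneg
  have hG0 : 0 < G := by
    have : 0 < lam * G := by rw [hbal]; positivity
    exact pos_of_mul_pos_right this hlam0.le
  have hint' : Integrable (fun r => 1 - I.h r) (I.D.restrict T) :=
    ((integrable_const _).sub hint).integrableOn
  have hneg : ∫ r in T, (1 - I.h r) ∂I.D = p - G := by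
    rw [integral_sub (integrable_const _) hint.integrableOn, setIntegral_const, smul_eq_mul,
      mul_one]
  have hGp : G ≤ p := by
    have : 0 ≤ ∫ r in T, (1 - I.h r) ∂I.D := integral_nonneg fun r => sub_nonneg.2 (h1 r)
    linarith
  refine ⟨lam, p, G, T, hlam0, hTm, hG0, hGp, measureReal_le_one, ?_, ?_, hbal, ?_⟩
  · simp [hp]
  · rw [← ofReal_integral_eq_lintegral_ofReal hint' (.of_forall fun r => sub_nonneg.2 (h1 r)),
      hneg, ← ofReal_measureReal, measureReal_compl hTm, probReal_univ,
      ← ENNReal.ofReal_add (sub_nonneg.2 hGp) (sub_nonneg.2 measureReal_le_one)]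
    congr 1
    ring
  · have e : ∀ r, ENNReal.ofReal (lam * I.h r - c_ver) =
        ENNReal.ofReal (max (lam * I.h r - c_ver) 0) := fun r => by
      rw [ENNReal.ofReal_max, ENNReal.ofReal_zero, max_eq_left zero_le]
    simp_rw [e]
    rw [← ofReal_integral_eq_lintegral_ofReal (hψint lam)
      (.of_forall fun r => le_max_right _ _)]
    exact ENNReal.ofReal_le_ofReal hlamψ.le

/-- Rounding `1 / p` and `1 / G` to powers of two costs at most a factor of four. -/
lemma exists_scales {c_rew c_ver lam p G : ℝ} (hrew : 0 < c_rew) (hver : 0 < c_ver)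
    (hG : 0 < G) (hGp : G ≤ p) (hp : p ≤ 1) (hbal : lam * G = c_rew + c_ver * p) :
    ∃ a b : ℕ, a ≤ b ∧ p * 2 ^ a ≤ 1 ∧ 1 ≤ G * 2 ^ b ∧
      c_rew * 2 ^ b + c_ver * 2 ^ (b - a) ≤ 4 * lam := by
  have hp0 : 0 < p := hG.trans_le hGp
  obtain ⟨a, ha1, ha2⟩ := exists_nat_pow_near ((one_le_div hp0).2 hp) (one_lt_two (α := ℝ))
  obtain ⟨n, hn1, hn2⟩ := exists_nat_pow_near ((one_le_div hG).2 (hGp.trans hp))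
    (one_lt_two (α := ℝ))
  rw [le_div_iff₀ hp0] at ha1
  rw [div_lt_iff₀ hp0] at ha2
  rw [le_div_iff₀ hG] at hn1
  rw [div_lt_iff₀ hG] at hn2
  have hab : a < n + 1 := by
    have : (2 : ℝ) ^ a < 2 ^ (n + 1) := by
      by_contra! h
      have h1 : (2 : ℝ) ^ (n + 1) * G ≤ 2 ^ a * p := by gcongr
      linarith
    exact (pow_lt_pow_iff_right₀ one_lt_two).1 this
  refine ⟨a, n + 1, hab.le, by linarith, by linarith, ?_⟩
  have hx : (2 : ℝ) ^ (n + 1 - a) * 2 ^ a = 2 ^ (n + 1) := by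
    rw [← pow_add, Nat.sub_add_cancel hab.le]
  set x : ℝ := 2 ^ (n + 1 - a)
  have hx0 : 0 < x := by positivity
  have hA0 : (0 : ℝ) < 2 ^ a := by positivity
  rw [pow_succ] at ha2 hx hn2 ⊢
  set A : ℝ := 2 ^ a
  set N : ℝ := 2 ^ n
  -- `x = 2 N / A` with `1 / A < 2 p` and `N ≤ 1 / G`
  have hxG : x * G ≤ 4 * p := by
    have h1 : x * G ≤ x * G * (A * 2 * p) := le_mul_of_one_le_right (by positivity) ha2.le
    have h2 : x * G * (A * 2 * p) = 4 * p * (N * G) := by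
      linear_combination (2 * p * G) * hx
    have h3 : 4 * p * (N * G) ≤ 4 * p * 1 := by gcongr
    linarith
  have h4 : (c_rew * (N * 2) + c_ver * x) * G ≤ 4 * lam * G := by
    have e1 : c_rew * (N * G) ≤ c_rew * 1 := by gcongr
    have e2 : c_ver * (x * G) ≤ c_ver * (4 * p) := by gcongr
    linarith
  exact le_of_mul_le_mul_right h4 hG

/-- With `2 ^ (b + t + 1)` fresh candidates, the two terms of the bound for the failure of a shell
are at most `exp (-2)` and `exp 2 / 64`. -/
lemma failure_le {p G : ℝ} (hG1 : G ≤ 1) (hp0 : 0 ≤ p) {a b : ℕ} (hab : a ≤ b)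
    (ha : p * 2 ^ a ≤ 1) (hb : 1 ≤ G * 2 ^ b) (t : ℕ) :
    (1 - G) ^ 2 ^ (b + t + 1) + (2 ^ (6 * 2 ^ (b + t - a)))⁻¹ * (1 + p) ^ 2 ^ (b + t + 1) ≤
      (3 / 10 : ℝ) := by
  have hexp1 := Real.exp_one_gt_d9
  have hexp2 := Real.exp_one_lt_d9
  have hsq : Real.exp 2 = Real.exp 1 ^ 2 := by
    rw [← Real.exp_nat_mul]
    norm_num
  have hlow : 7.389 ≤ Real.exp 2 := by
    rw [hsq]
    nlinarith
  have hupp : Real.exp 2 ≤ 7.39 := by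
    rw [hsq]
    nlinarith
  have hG0 : 0 ≤ G := by
    by_contra! h
    have : G * 2 ^ b < 0 := mul_neg_of_neg_of_pos h (by positivity)
    linarith
  have h1 : (1 - G) ^ 2 ^ (b + t + 1) ≤ (Real.exp 2)⁻¹ := by
    calc (1 - G) ^ 2 ^ (b + t + 1) ≤ Real.exp (-G) ^ 2 ^ (b + t + 1) :=
          pow_le_pow_left₀ (by linarith) (Real.one_sub_le_exp_neg G) _
      _ = Real.exp (-(G * 2 ^ b * 2 ^ t * 2)) := by
          rw [← Real.exp_nat_mul]
          congr 1
          push_cast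
          ring
      _ ≤ Real.exp (-2) := by
          gcongr
          have : (1 : ℝ) ≤ 2 ^ t := one_le_pow₀ one_le_two
          nlinarith [mul_le_mul hb this zero_le_one (by linarith)]
      _ = _ := Real.exp_neg 2
  set n := 2 ^ (b + t - a) with hn
  have hn1 : 1 ≤ n := Nat.one_le_two_pow
  have hna : 2 ^ (b + t + 1) = 2 ^ a * (2 * n) := by
    rw [hn, ← pow_succ', ← pow_add]
    congr 1
    omega
  have h2 : (2 ^ (6 * n))⁻¹ * (1 + p) ^ 2 ^ (b + t + 1) ≤ Real.exp 2 / 64 := by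
    have e1 : (1 + p) ^ 2 ^ (b + t + 1) ≤ Real.exp 2 ^ n := by
      calc (1 + p) ^ 2 ^ (b + t + 1) ≤ Real.exp p ^ 2 ^ (b + t + 1) := by
            gcongr
            linarith [Real.add_one_le_exp p]
        _ = Real.exp ((p * 2 ^ a) * (2 * n)) := by
            rw [hna, ← Real.exp_nat_mul]
            congr 1
            push_cast
            ring
        _ ≤ Real.exp (1 * (2 * n)) := by gcongr
        _ = _ := by
            rw [← Real.exp_nat_mul]
            congr 1
            ring
    calc (2 ^ (6 * n))⁻¹ * (1 + p) ^ 2 ^ (b + t + 1)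
        ≤ (2 ^ (6 * n))⁻¹ * Real.exp 2 ^ n := by gcongr
      _ = (Real.exp 2 / 64) ^ n := by
          rw [pow_mul, div_pow, div_eq_inv_mul]
          norm_num
      _ ≤ (Real.exp 2 / 64) ^ 1 :=
          pow_le_pow_of_le_one (by positivity) (by linarith) hn1
      _ = _ := pow_one _
  have h3 : (Real.exp 2)⁻¹ ≤ 7.389⁻¹ := by gcongr
  calc _ ≤ (Real.exp 2)⁻¹ + Real.exp 2 / 64 := add_le_add h1 h2
    _ ≤ 7.389⁻¹ + 7.39 / 64 := by gcongr
    _ ≤ 3 / 10 := by norm_num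

/-- Shell prices double, and the probability of reaching a shell shrinks by the factor `3 / 10`
from shell `s₀` on: both parts of the sum are geometric. -/
lemma tsum_price_le {c : ℝ} (hc : 0 ≤ c) (s₀ : ℕ) :
    ∑' s, ENNReal.ofReal (16 * (2 ^ s * c)) * ENNReal.ofReal (3 / 10) ^ (s - s₀) ≤
      ENNReal.ofReal (56 * (2 ^ s₀ * c)) := by
  rw [← Summable.sum_add_tsum_nat_add' (k := s₀)
    (f := fun s => ENNReal.ofReal (16 * (2 ^ s * c)) * ENNReal.ofReal (3 / 10) ^ (s - s₀))
    ENNReal.summable]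
  have h1 : ∑ s ∈ Finset.range s₀,
      ENNReal.ofReal (16 * (2 ^ s * c)) * ENNReal.ofReal (3 / 10) ^ (s - s₀) ≤
        ENNReal.ofReal (16 * (2 ^ s₀ * c)) := by
    have e : ∀ s ∈ Finset.range s₀,
        ENNReal.ofReal (16 * (2 ^ s * c)) * ENNReal.ofReal (3 / 10) ^ (s - s₀) =
          ENNReal.ofReal (16 * (2 ^ s * c)) := fun s hs => by
      rw [Nat.sub_eq_zero_of_le (Finset.mem_range.1 hs).le, pow_zero, mul_one]
    rw [Finset.sum_congr rfl e, ← ENNReal.ofReal_sum_of_nonneg fun s _ => by positivity]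
    refine ENNReal.ofReal_le_ofReal ?_
    rw [← Finset.mul_sum, ← Finset.sum_mul, geom_sum_eq (by norm_num)]
    have : (2 : ℝ) ^ s₀ * c - c ≤ 2 ^ s₀ * c := by linarith
    calc 16 * ((2 ^ s₀ - 1) / (2 - 1) * c) = 16 * (2 ^ s₀ * c - c) := by ring
      _ ≤ _ := by gcongr
  have h2 : ∑' t, ENNReal.ofReal (16 * (2 ^ (t + s₀) * c)) *
      ENNReal.ofReal (3 / 10) ^ (t + s₀ - s₀) = ENNReal.ofReal (40 * (2 ^ s₀ * c)) := by
    have e : ∀ t : ℕ, ENNReal.ofReal (16 * (2 ^ (t + s₀) * c)) *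
        ENNReal.ofReal (3 / 10) ^ (t + s₀ - s₀) =
          ENNReal.ofReal (16 * (2 ^ s₀ * c) * (3 / 5) ^ t) := fun t => by
      rw [Nat.add_sub_cancel, ← ENNReal.ofReal_pow (by norm_num),
        ← ENNReal.ofReal_mul (by positivity)]
      congr 1
      rw [pow_add, show (3 / 5 : ℝ) = 2 * (3 / 10) by norm_num, mul_pow]
      ring
    simp_rw [e]
    rw [← ENNReal.ofReal_tsum_of_nonneg (fun t => by positivity)
      ((summable_geometric_of_lt_one (by norm_num) (by norm_num)).mul_left _), tsum_mul_left,
      tsum_geometric_of_lt_one (by norm_num) (by norm_num)]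
    congr 1
    ring
  rw [h2]
  refine (add_le_add_left h1 _).trans ?_
  rw [← ENNReal.ofReal_add (by positivity) (by positivity)]
  exact ENNReal.ofReal_le_ofReal (by linarith)

end Threshold

/-! ### Competitiveness of the shellwise policy -/

/-- The comparison value `lam` is the worth of a positive label at which search breaks even. It is a
lower bound for the cost of every sound policy by `le_Jstar`, and up to a constant it is an upper
bound for the cost of the shellwise policy. -/
lemma exists_value_le_Jstar {c_rew c_ver : ℝ} (hrew : 0 < c_rew) (hver : 0 < c_ver)
    {rank : List (ℕ × ℝ) → List (ℕ × ℝ)} (hrank : IsRanking rank) (I : SearchInstance)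
    (hI : Monotone I.h) (hpos : 0 < ∫ r, I.h r ∂I.D) :
    ∃ lam : ℝ, ENNReal.ofReal lam ≤ Jstar c_rew c_ver I ∧
      (adap c_rew c_ver rank).expectedCost c_rew c_ver I.streamLaw ≤
        400 * ENNReal.ofReal lam := by
  obtain ⟨lam, p, G, T, hlam, hT, hG, hGp, hp, hDT, hfail, hbal, hw⟩ :=
    exists_threshold hrew hver I hpos
  obtain ⟨a, b, hab, ha, hb, hcost⟩ := exists_scales hrew hver hG hGp hp hbal
  obtain ⟨s₀, hs₀⟩ := exists_mem_shell hrew hver hab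
  have hmin : 0 < min c_rew c_ver := lt_min hrew hver
  refine ⟨lam, le_Jstar I hlam.le hrew.le hver.le hw, ?_⟩
  have hp0 : 0 ≤ p := hG.le.trans hGp
  have hq : ∀ t, (∫⁻ r in T, I.negProb r ∂I.D + I.D Tᶜ) ^ 2 ^ (b + t + 1) +
      ((2 : ℝ≥0∞) ^ (6 * 2 ^ (b + t - a)))⁻¹ * (1 + I.D T) ^ 2 ^ (b + t + 1) ≤
        ENNReal.ofReal (3 / 10) := fun t => by
    have e : ((2 : ℝ≥0∞) ^ (6 * 2 ^ (b + t - a)))⁻¹ =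
        ENNReal.ofReal ((2 ^ (6 * 2 ^ (b + t - a)))⁻¹) := by
      rw [ENNReal.ofReal_inv_of_pos (by positivity), ENNReal.ofReal_pow zero_le_two]
      simp
    have e1 : (1 : ℝ≥0∞) + ENNReal.ofReal p = ENNReal.ofReal (1 + p) := by
      rw [ENNReal.ofReal_add zero_le_one hp0, ENNReal.ofReal_one]
    have hG1 : 0 ≤ 1 - G := by linarith
    unfold SearchInstance.negProb
    rw [hfail, hDT, e, e1, ← ENNReal.ofReal_pow hG1, ← ENNReal.ofReal_pow (by positivity),
      ← ENNReal.ofReal_mul (by positivity), ← ENNReal.ofReal_add (by positivity) (by positivity)]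
    exact ENNReal.ofReal_le_ofReal (failure_le (by linarith) hp0 hab ha hb t)
  calc (adap c_rew c_ver rank).expectedCost c_rew c_ver I.streamLaw
      ≤ ∑' s, shellPrice c_rew c_ver s *
          ∫⁻ ω, reachBound c_rew c_ver I.negProb T a b s₀ (scores ω) s ∂I.streamLaw :=
        expectedCost_adap_le hrew hver hrank I
          (Y := fun R => reachBound c_rew c_ver I.negProb T a b s₀ R)
          (measurable_reachBound I.measurable_negProb hT a b s₀)
          (isDecay_reachBound hrew hver hrank (I.antitone_negProb hI) I.negProb_le_one T hs₀)
    _ ≤ ∑' s, ENNReal.ofReal (16 * (2 ^ s * min c_rew c_ver)) *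
          ENNReal.ofReal (3 / 10) ^ (s - s₀) :=
        ENNReal.tsum_le_tsum fun s => mul_le_mul' (shellPrice_le hrew hver s)
          (lintegral_reachBound_le hrew hver I I.measurable_negProb hT hs₀ hq s)
    _ ≤ ENNReal.ofReal (56 * (2 ^ s₀ * min c_rew c_ver)) := tsum_price_le hmin.le s₀
    _ ≤ ENNReal.ofReal (400 * lam) := by
        refine ENNReal.ofReal_le_ofReal ?_
        -- the price of `(a, b)` lies between `2 ^ s₀ * min c_rew c_ver` and `4 * lam`
        have := hs₀.2.1.trans hcost
        linarith
    _ = 400 * ENNReal.ofReal lam := by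
        rw [ENNReal.ofReal_mul (by norm_num)]
        norm_num

section Induced

variable {𝒴 : Type*} [MeasurableSpace 𝒴] {I : SearchInstance} {μ : Measure 𝒴} {RM : 𝒴 → ℝ}
  {Ver : 𝒴 → Bool}

/-- The pair of score and label of a random response has the law prescribed by the instance that
it induces. -/
lemma SearchInstance.InducedBy.map_eq_pairLaw [IsProbabilityMeasure μ] (h : I.InducedBy μ RM Ver)
    (hRM : Measurable RM) (hVer : Measurable Ver) :
    μ.map (fun y => (RM y, Ver y)) = I.pairLaw := by
  have hm := I.measurable_h
  have m1 : Measurable (fun r : ℝ => (r, true)) := by fun_prop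
  have m2 : Measurable (fun r : ℝ => (r, false)) := by fun_prop
  have hV : MeasurableSet {y | Ver y = true} := hVer (measurableSet_singleton true)
  ext S hS
  set S₁ : Set ℝ := (fun r => (r, true)) ⁻¹' S with hS₁
  set S₂ : Set ℝ := (fun r => (r, false)) ⁻¹' S with hS₂
  have hS₁m : MeasurableSet S₁ := m1 hS
  have hS₂m : MeasurableSet S₂ := m2 hS
  rw [Measure.map_apply (hRM.prodMk hVer) hS, SearchInstance.pairLaw, Measure.add_apply,
    Measure.map_apply m1 hS, Measure.map_apply m2 hS, withDensity_apply _ hS₁m,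
    withDensity_apply _ hS₂m, ← h.2 S₁ hS₁m,
    ← measure_inter_add_sdiff ((fun y => (RM y, Ver y)) ⁻¹' S) hV]
  congr 1
  · congr 1
    ext y
    simp only [Set.mem_inter_iff, Set.mem_preimage, Set.mem_ofPred_eq, hS₁]
    constructor
    · rintro ⟨h1, h2⟩
      exact ⟨h2 ▸ h1, h2⟩
    · rintro ⟨h1, h2⟩
      exact ⟨h2 ▸ h1, h2⟩
  · have hfin : μ {y | RM y ∈ S₂ ∧ Ver y = true} ≠ ∞ := measure_ne_top _ _
    refine (ENNReal.add_right_inj hfin).1 ?_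
    have e1 : μ {y | RM y ∈ S₂ ∧ Ver y = true} +
        μ (((fun y => (RM y, Ver y)) ⁻¹' S) \ {y | Ver y = true}) = μ (RM ⁻¹' S₂) := by
      rw [← measure_inter_add_sdiff (RM ⁻¹' S₂) hV]
      congr 2
      ext y
      simp only [Set.mem_sdiff, Set.mem_preimage, Set.mem_ofPred_eq, hS₂, Bool.not_eq_true]
      constructor
      · rintro ⟨h1, h2⟩
        exact ⟨h2 ▸ h1, h2⟩
      · rintro ⟨h1, h2⟩
        exact ⟨h2 ▸ h1, h2⟩
    rw [e1, h.2 S₂ hS₂m, ← lintegral_add_left hm.ennreal_ofReal, ← Measure.map_apply hRM hS₂m,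
      ← h.1]
    simp_rw [I.ofReal_h_add]
    simp

lemma SearchInstance.InducedBy.integral_h_pos (h : I.InducedBy μ RM Ver)
    (hpos : 0 < μ {y | Ver y = true}) : 0 < ∫ r, I.h r ∂I.D := by
  have hint : Integrable I.h I.D := Integrable.of_bound I.measurable_h.aestronglyMeasurable 1
    (.of_forall fun r => by rw [Real.norm_of_nonneg (I.h_mem r).1]; exact (I.h_mem r).2)
  have e := h.2 Set.univ MeasurableSet.univ
  simp only [Set.mem_univ, true_and, Measure.restrict_univ] at e
  rw [e, ← ofReal_integral_eq_lintegral_ofReal hint (.of_forall fun r => (I.h_mem r).1)] at hpos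
  exact ENNReal.ofReal_pos.1 hpos

lemma SearchInstance.InducedBy.map_stream_eq [IsProbabilityMeasure μ] (h : I.InducedBy μ RM Ver)
    (hRM : Measurable RM) (hVer : Measurable Ver) :
    (Measure.infinitePi fun _ : ℕ => μ).map (fun Y j => (RM (Y j), Ver (Y j))) =
      I.streamLaw := by
  have := Measure.infinitePi_map_pi (μ := fun _ : ℕ => μ)
    (f := fun _ y => (RM y, Ver y)) fun _ => hRM.prodMk hVer
  rw [this]
  simp_rw [h.map_eq_pairLaw hRM hVer]

end Induced

lemma exists_output_of_cost_ne_top {c_rew c_ver : ℝ} {A : Policy} {u : A.Seed}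
    {ω : ℕ → ℝ × Bool} (h : A.cost c_rew c_ver u ω ≠ ∞) : ∃ i, A.output u ω = some i := by
  rw [← Option.ne_none_iff_exists', Ne, output_eq_none_iff, not_not]
  by_contra hs
  exact h (dif_neg hs)

end ActiveSearch

theorem mainTheorem2 (c_rew c_ver : ℝ) (hrew : 0 < c_rew) (hver : 0 < c_ver)
    (rank : List (ℕ × ℝ) → List (ℕ × ℝ)) (hrank : ActiveSearch.IsRanking rank) :
    -- the shellwise policy is a sound active search policy
    (ActiveSearch.adap c_rew c_ver rank).IsSound ∧
    -- and for all prompts, generators, reward models and verifiers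
    ∀ {𝒳 : Type*} {𝒴 : Type*} [MeasurableSpace 𝒴]
      (gen : 𝒳 → Measure 𝒴) [∀ x, IsProbabilityMeasure (gen x)]
      (RM : 𝒳 → 𝒴 → ℝ) (Ver : 𝒳 → 𝒴 → Bool)
      (_ : ∀ x, Measurable (RM x)) (_ : ∀ x, Measurable (Ver x))
      (x : 𝒳) (_ : 0 < gen x {y | Ver x y = true})
      (I : ActiveSearch.SearchInstance) (_ : I.InducedBy (gen x) (RM x) (Ver x))
      (_ : Monotone I.h),
      -- every returned response is verified
      (∀ (Y : ℕ → 𝒴) (i : ℕ),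
        (ActiveSearch.adap c_rew c_ver rank).output () (fun j => (RM x (Y j), Ver x (Y j))) =
          some i → Ver x (Y i) = true) ∧
      -- a response is returned almost surely
      (∀ᵐ Y ∂(Measure.infinitePi fun _ : ℕ => gen x), ∃ i,
        (ActiveSearch.adap c_rew c_ver rank).output () (fun j => (RM x (Y j), Ver x (Y j))) =
          some i) ∧
      -- the expected cost on i.i.d. responses
      (ActiveSearch.adap c_rew c_ver rank).expectedCost c_rew c_ver
          ((Measure.infinitePi fun _ : ℕ => gen x).map
            fun Y j => (RM x (Y j), Ver x (Y j))) ≤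
        400 * ActiveSearch.Jstar c_rew c_ver I := by
  refine ⟨ActiveSearch.isSound_adap hrank, ?_⟩
  intro 𝒳 𝒴 _ gen _ RM Ver hRM hVer x hpos I hI hmono
  have hlaw := hI.map_stream_eq (hRM x) (hVer x)
  obtain ⟨lam, hlam, hcost⟩ := ActiveSearch.exists_value_le_Jstar hrew hver hrank I hmono
    (hI.integral_h_pos hpos)
  have hstream : Measurable fun (Y : ℕ → 𝒴) (j : ℕ) => (RM x (Y j), Ver x (Y j)) :=
    measurable_pi_iff.2 fun j => ((hRM x).prodMk (hVer x)).comp (measurable_pi_apply j)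
  refine ⟨fun Y i hi => ActiveSearch.label_of_output _ _ _ hi, ?_, ?_⟩
  · have hne : ∫⁻ ω, (ActiveSearch.adap c_rew c_ver rank).cost c_rew c_ver () ω
        ∂I.streamLaw ≠ ∞ := by
      rw [← ActiveSearch.expectedCost_adap_eq_lintegral hrew hver hrank]
      exact ne_top_of_le_ne_top (by finiteness) hcost
    have hae := ae_lt_top (ActiveSearch.measurable_cost_adap hrew hver hrank) hne
    rw [← hlaw] at hae
    filter_upwards [ae_of_ae_map hstream.aemeasurable hae] with Y hY
    exact ActiveSearch.exists_output_of_cost_ne_top hY.ne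
  · rw [hlaw]
    exact hcost.trans (mul_le_mul_right hlam 400)
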